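/- Let $T>0$, $p\ge \frac13$, $c\in\mathbb R$, and let $e:\mathbb R\to\mathbb R$ be $T$-periodic with $e\in L^2(0,T)$ and $\int_0^T e(t)\,dt=0$. For $\mu\in\mathbb R$ consider the problem $$u''(t)+c\,u'(t)+\frac{1}{u(t)^p}=\mu+e(t),\qquad u(t+T)=u(t). \tag{1}$$ A positive solution of (1) means a (continuous) $T$-periodic function $u:\mathbb R\to(0,\infty)$ of class $W^{2,2}_{\rm loc}(\mathbb R)$, i.e. whose weak derivatives $u',u''$ on $\mathbb R$ are square integrable over a period, that satisfies the equation for almost every $t$. Then: (i) for every $\mu\in\mathbb R$, problem (1) has a unique positive solution if and only if $\mu>0$; (ii) writing $u(t)=\xi+U(t)$ with $\int_0^T U(t)\,dt=0$, the average $\xi$ is a global parameter: if $u_1$, $u_2$ are positive solutions of (1) for $\mu=\mu_1$, $\mu=\mu_2$ respectively and they have the same average, then $u_1=u_2$ and $\mu_1=\mu_2$; (iii) there are $\xi_0\ge 0$ and a continuous, strictly decreasing function $\varphi:(\xi_0,\infty)\to\mathbb R$ such that the set of all pairs $(\xi,\mu)$ for which (1) has a positive solution of average $\xi$ is exactly the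 graph $\{(\xi,\varphi(\xi)):\xi>\xi_0\}$ (in particular, $\xi_0$ and $\varphi$ are unique), and $$\lim_{\xi\to\xi_0^+}\varphi(\xi)=\infty,\qquad \lim_{\xi\to\infty}\varphi(\xi)=0.$$ If, moreover, $p\le 1$, then $\xi_0=0$. -/

import Mathlib

open Set Filter Topology MeasureTheory
open scoped ContDiff

/-- `g` is the weak (distributional) derivative of `f` on the real line: both are locally
integrable and `∫ f φ' = - ∫ g φ` for every test function `φ ∈ C_c^∞(ℝ)`. -/
def HasWeakDerivReal (f g : ℝ → ℝ) : Prop :=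
  LocallyIntegrable f ∧ LocallyIntegrable g ∧
    ∀ φ : ℝ → ℝ, ContDiff ℝ ∞ φ → HasCompactSupport φ →
      ∫ t, f t * deriv φ t = - ∫ t, g t * φ t

/-- `f` is square integrable over the period interval `(0, T)`. -/
def MemL2Period (T : ℝ) (f : ℝ → ℝ) : Prop :=
  MemLp f 2 (volume.restrict (Ioo 0 T))

/-- `u` is a positive `T`-periodic strong solution, of class `W^{2,2}`, of
`u'' + c u' + 1 / u ^ p = μ + e`. The function `u` is the continuous representative of its class;
`u₁` and `u₂` are the weak derivatives `u'` and `u''`. -/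
structure IsPositivePeriodicSolution (T p c : ℝ) (e : ℝ → ℝ) (μ : ℝ) (u : ℝ → ℝ) : Prop where
  continuous : Continuous u
  periodic : Function.Periodic u T
  pos : ∀ t, 0 < u t
  strong : ∃ u₁ u₂ : ℝ → ℝ,
    HasWeakDerivReal u u₁ ∧ HasWeakDerivReal u₁ u₂ ∧
    MemL2Period T u ∧ MemL2Period T u₁ ∧ MemL2Period T u₂ ∧
    ∀ᵐ t : ℝ, u₂ t + c * u₁ t + 1 / (u t) ^ p = μ + e t

/-- `u` has average `ξ` over `(0, T)`: `u = ξ + U` where `U` has zero integral over `(0, T)`. -/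
def HasAverage (T : ℝ) (u : ℝ → ℝ) (ξ : ℝ) : Prop :=
  ∃ U : ℝ → ℝ, (∀ t, u t = ξ + U t) ∧ ∫ t in (0 : ℝ)..T, U t = 0

/-- The set of all pairs `(ξ, μ)` such that the problem with parameter `μ` has a positive
`T`-periodic strong solution of average `ξ`. -/
def solutionSet (T p c : ℝ) (e : ℝ → ℝ) : Set (ℝ × ℝ) :=
  {q | ∃ u : ℝ → ℝ, IsPositivePeriodicSolution T p c e q.2 u ∧ HasAverage T u q.1}

/-! ### Weak derivatives on the line and primitives -/

/-! Write `g(x) = 1 / x ^ p` and let `P` be a primitive of `e`, periodic because `e` has mean zero.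
The equation becomes the system `u' = Q + P - c u`, `Q' = μ - g(u)`, whose right-hand sides are
continuous, so classical calculus applies. Since `Q` is periodic, Rolle's theorem gives a point with
`g(u) = μ`, whence `μ > 0`. At a maximum of the difference of two solutions the maximum principle
shows that a larger `μ` gives a smaller solution (`le_of_le`). This yields uniqueness for fixed `μ`
and, since ordered solutions with equal averages coincide, determination by the average
(`eq_of_integral_eq`).

Existence rests on one energy estimate, `integral_sq_le`. Testing the equation with `μ - g(u)` kills
the damping term, and the second-order term has a sign because `g` decreases, so the `L²` norm of `μ
- g(u)` over a period is at most that of `e`. By Cauchy–Schwarz `u'` leaves its zero at the minimum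
`t₀` no faster than the square root, so `u(t₀ + s) ≤ u(t₀) + K s^(3/2)`, with `K` independent of `μ`
and `g` (`exists_apriori_bound`). For a truncated `g` a solution comes from a contraction
(`exists_system_of_lipschitz`). If its minimum were too small, `g(u)²` would dominate a multiple of
`s^(-3p)`, hence of `1/s` since `p ≥ 1/3`, on an interval long enough to violate the `L²` bound. So
the truncation is never felt (`exists_pos_solution`).

Finally the average is a continuous, strictly decreasing function of `μ`. The oscillation bound
makes it large for small `μ`, and the energy estimate makes it tend to `0` as `μ → ∞`
(`average_properties`). Its inverse is `φ`, and `ξ₀ = 0` for every `p ≥ 1/3`. -/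

/-- Only `φ` is `C¹`; `F` is merely absolutely continuous. This serves both the weak derivatives and
the energy estimate, where `F = Q + P`. -/
theorem integral_primitive_mul_deriv {F f φ φ' : ℝ → ℝ}
    (hf : ∀ a b, IntervalIntegrable f volume a b) (hF : ∀ a b, ∫ t in a..b, f t = F b - F a)
    (hφ : ∀ t, HasDerivAt φ (φ' t) t) (hφ' : Continuous φ') (a b : ℝ) :
    ∫ t in a..b, F t * φ' t = F b * φ b - F a * φ a - ∫ t in a..b, f t * φ t := by
  have hFeq : F = fun x => F a + ∫ t in a..x, f t := by
    funext x; rw [hF]; ring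
  have hconst : AbsolutelyContinuousOnInterval (fun _ : ℝ => F a) a b :=
    (contDiff_const.contDiffOn).absolutelyContinuousOnInterval
  have hFac : AbsolutelyContinuousOnInterval F a b := by
    rw [hFeq]
    exact hconst.add ((hf a b).absolutelyContinuousOnInterval_intervalIntegral left_mem_uIcc)
  have hd : deriv φ = φ' := funext fun t => (hφ t).deriv
  have hφc : ContDiff ℝ 1 φ := by
    rw [contDiff_one_iff_deriv]
    exact ⟨fun t => (hφ t).differentiableAt, hd ▸ hφ'⟩
  have hφac : AbsolutelyContinuousOnInterval φ a b :=
    hφc.contDiffOn.absolutelyContinuousOnInterval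
  have key := hFac.integral_mul_deriv_eq_deriv_mul hφac
  rw [hd] at key
  rw [key]
  congr 1
  apply intervalIntegral.integral_congr_ae
  filter_upwards [(hf a b).ae_hasDerivAt_integral] with x hx hxm
  have h1 := (hx (uIoc_subset_uIcc hxm) a left_mem_uIcc).const_add (F a)
  have h2 : HasDerivAt F (f x) x := by rw [hFeq]; exact h1
  rw [h2.deriv]

theorem exists_support_subset_Ioc {φ : ℝ → ℝ} (hφ : HasCompactSupport φ) :
    ∃ R, 0 < R ∧ ∀ t, t ≤ -R ∨ R ≤ t → φ t = 0 := by
  obtain ⟨r, hr⟩ := hφ.isCompact.isBounded.subset_closedBall 0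
  refine ⟨max r 0 + 1, by positivity, fun t ht => ?_⟩
  by_contra hne
  have h1 := hr (subset_tsupport φ hne)
  rw [Metric.mem_closedBall, Real.dist_eq, sub_zero] at h1
  have h2 := le_max_left r 0
  have h3 := abs_le.1 h1
  rcases ht with ht | ht <;> linarith [h3.1, h3.2]

theorem integral_eq_intervalIntegral {F : ℝ → ℝ} {R : ℝ}
    (h : ∀ t, t ≤ -R ∨ R ≤ t → F t = 0) : ∫ t, F t = ∫ t in (-R)..R, F t := by
  rw [intervalIntegral.integral_eq_integral_of_support_subset]
  intro t ht
  by_contra hn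
  apply ht
  apply h
  by_contra! hc
  exact hn ⟨hc.1, hc.2.le⟩

theorem deriv_eq_zero_of_le {φ : ℝ → ℝ} {R : ℝ}
    (h : ∀ t, t ≤ -R ∨ R ≤ t → φ t = 0) : ∀ t, t ≤ -(R + 1) ∨ R + 1 ≤ t → deriv φ t = 0 := by
  intro t ht
  have : φ =ᶠ[𝓝 t] fun _ => 0 := by
    rcases ht with ht | ht
    · filter_upwards [Iio_mem_nhds (show t < -R by linarith)] with s hs
      exact h s (Or.inl (le_of_lt hs))
    · filter_upwards [Ioi_mem_nhds (show R < t by linarith)] with s hs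
      exact h s (Or.inr (le_of_lt hs))
  rw [this.deriv_eq]; simp

theorem locallyIntegrable_of_intervalIntegrable {f : ℝ → ℝ}
    (hf : ∀ a b, IntervalIntegrable f volume a b) : LocallyIntegrable f := by
  intro x
  refine ⟨Ioc (x - 1) (x + 1), Ioc_mem_nhds (by linarith) (by linarith), ?_⟩
  exact (hf (x - 1) (x + 1)).1

theorem continuous_of_primitive {F f : ℝ → ℝ}
    (hf : ∀ a b, IntervalIntegrable f volume a b) (hF : ∀ a b, ∫ t in a..b, f t = F b - F a) :
    Continuous F := by
  have hFeq : F = fun x => F 0 + ∫ t in (0 : ℝ)..x, f t := by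
    funext x; rw [hF]; ring
  rw [hFeq]
  exact continuous_const.add (intervalIntegral.continuous_primitive hf 0)

theorem hasWeakDerivReal_of_primitive {F f : ℝ → ℝ}
    (hf : ∀ a b, IntervalIntegrable f volume a b) (hF : ∀ a b, ∫ t in a..b, f t = F b - F a) :
    HasWeakDerivReal F f := by
  refine ⟨(continuous_of_primitive hf hF).locallyIntegrable,
    locallyIntegrable_of_intervalIntegrable hf, fun φ hφ hc => ?_⟩
  obtain ⟨R, hR, h⟩ := exists_support_subset_Ioc hc
  have h' := deriv_eq_zero_of_le h
  have h1 : ∀ t, t ≤ -(R + 1) ∨ R + 1 ≤ t → φ t = 0 := fun t ht =>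
    h t (ht.imp (fun h => by linarith) (fun h => by linarith))
  rw [integral_eq_intervalIntegral (R := R + 1) (fun t ht => by rw [h' t ht, mul_zero]),
    integral_eq_intervalIntegral (F := fun t => f t * φ t) (R := R + 1)
      (fun t ht => by rw [h1 t ht, mul_zero]),
    integral_primitive_mul_deriv hf hF
      (fun t => (hφ.differentiable (by simp)).differentiableAt.hasDerivAt)
      (hφ.continuous_deriv (by simp)), h1 _ (Or.inl le_rfl), h1 _ (Or.inr le_rfl)]
  ring

/-- A test function with vanishing integral is the derivative of a test function. -/
theorem exists_test_primitive {θ : ℝ → ℝ} (hθ : ContDiff ℝ ∞ θ) (hc : HasCompactSupport θ)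
    (h0 : ∫ t, θ t = 0) :
    ∃ φ : ℝ → ℝ, ContDiff ℝ ∞ φ ∧ HasCompactSupport φ ∧ deriv φ = θ := by
  obtain ⟨R, hR, h⟩ := exists_support_subset_Ioc hc
  have hd : ∀ t, HasDerivAt (fun x => ∫ s in (-R)..x, θ s) (θ t) t := fun t =>
    hθ.continuous.integral_hasStrictDerivAt _ _ |>.hasDerivAt
  have hder : deriv (fun x => ∫ s in (-R)..x, θ s) = θ := funext fun t => (hd t).deriv
  refine ⟨fun x => ∫ s in (-R)..x, θ s, ?_, ?_, hder⟩
  · rw [contDiff_infty_iff_deriv, hder]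
    exact ⟨fun t => (hd t).differentiableAt, hθ⟩
  · refine HasCompactSupport.intro (isCompact_Icc (a := -R) (b := R)) fun x hx => ?_
    have hz : ∀ a b, (∀ s ∈ uIcc a b, θ s = 0) → ∫ s in a..b, θ s = 0 := fun a b hs => by
      rw [intervalIntegral.integral_congr (g := fun _ => (0 : ℝ)) hs]; simp
    rw [mem_Icc, not_and_or, not_le, not_le] at hx
    rcases hx with hx | hx
    · apply hz
      intro s hs
      rw [uIcc_of_ge hx.le] at hs
      exact h s (Or.inl hs.2)
    · rw [← intervalIntegral.integral_add_adjacent_intervals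
        (hθ.continuous.intervalIntegrable (-R) R) (hθ.continuous.intervalIntegrable R x),
        ← integral_eq_intervalIntegral h, h0, zero_add]
      apply hz
      intro s hs
      rw [uIcc_of_le hx.le] at hs
      exact h s (Or.inr hs.1)

theorem exists_test_integral_eq_one :
    ∃ ψ : ℝ → ℝ, ContDiff ℝ ∞ ψ ∧ HasCompactSupport ψ ∧ ∫ t, ψ t = 1 := by
  let b : ContDiffBump (0 : ℝ) := ⟨1, 2, one_pos, one_lt_two⟩
  exact ⟨b.normed volume, b.contDiff_normed, b.hasCompactSupport_normed, b.integral_normed⟩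

theorem integrable_mul_test {h η : ℝ → ℝ} (hh : LocallyIntegrable h)
    (hη : Continuous η) (hc : HasCompactSupport η) : Integrable (fun t => h t * η t) := by
  simpa [mul_comm] using hh.integrable_smul_left_of_hasCompactSupport hη hc

/-- A locally integrable function with vanishing weak derivative is constant. -/
theorem ae_const_of_weakDeriv_zero {h : ℝ → ℝ} (hh : LocallyIntegrable h)
    (h0 : ∀ φ : ℝ → ℝ, ContDiff ℝ ∞ φ → HasCompactSupport φ → ∫ t, h t * deriv φ t = 0) :
    ∃ k : ℝ, ∀ᵐ t, h t = k := by
  obtain ⟨ψ, hψ, hψc, hψ1⟩ := exists_test_integral_eq_one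
  refine ⟨∫ t, h t * ψ t, ?_⟩
  refine ae_eq_of_integral_contDiff_smul_eq hh (locallyIntegrable_const _) fun η hη hηc => ?_
  have iη : Integrable η := hη.continuous.integrable_of_hasCompactSupport hηc
  have iψ : Integrable ψ := hψ.continuous.integrable_of_hasCompactSupport hψc
  have hmul : HasCompactSupport (fun t => (∫ s, η s) * ψ t) := hψc.mul_left
  -- Subtracting a multiple of the unit-mass bump `ψ` makes the integral vanish, so the hypothesis
  -- applies to the primitive.
  obtain ⟨φ, hφ, hφc, hd⟩ := exists_test_primitive (θ := fun t => η t - (∫ s, η s) * ψ t)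
    (hη.sub (contDiff_const.mul hψ)) (hηc.sub hmul)
    (by rw [integral_sub iη (iψ.const_mul _), integral_const_mul, hψ1]; ring)
  have key := h0 φ hφ hφc
  rw [hd] at key
  have e1 : (fun t => h t * (η t - (∫ s, η s) * ψ t))
      = fun t => h t * η t - (∫ s, η s) * (h t * ψ t) := by funext t; ring
  rw [e1, integral_sub (integrable_mul_test hh hη.continuous hηc)
    ((integrable_mul_test hh hψ.continuous hψc).const_mul _), integral_const_mul] at key
  simp only [smul_eq_mul]
  rw [integral_mul_const]
  simp_rw [mul_comm (η _)]
  linarith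

theorem intervalIntegrable_of_locallyIntegrable {g : ℝ → ℝ} (hg : LocallyIntegrable g) (a b : ℝ) :
    IntervalIntegrable g volume a b :=
  ((hg.integrableOn_isCompact isCompact_uIcc).mono_set uIoc_subset_uIcc) |>
    intervalIntegrable_iff.2

theorem HasWeakDerivReal.ae_eq_primitive {f g : ℝ → ℝ} (h : HasWeakDerivReal f g) :
    ∃ k : ℝ, ∀ᵐ t, f t = k + ∫ s in (0 : ℝ)..t, g s := by
  obtain ⟨hf, hg, hw⟩ := h
  have hgi := intervalIntegrable_of_locallyIntegrable hg
  have hG : ∀ a b, ∫ t in a..b, g t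
      = (fun x => ∫ s in (0 : ℝ)..x, g s) b - (fun x => ∫ s in (0 : ℝ)..x, g s) a := fun a b => by
    simp only
    rw [intervalIntegral.integral_interval_sub_left (hgi _ _) (hgi _ _)]
  obtain ⟨hGl, -, hGw⟩ := hasWeakDerivReal_of_primitive hgi hG
  obtain ⟨k, hk⟩ := ae_const_of_weakDeriv_zero (hf.sub hGl) (fun φ hφ hc => by
    have hdc : Continuous (deriv φ) := hφ.continuous_deriv (by simp)
    have e1 : (fun t => (f - fun x => ∫ s in (0 : ℝ)..x, g s) t * deriv φ t)
      = fun t => f t * deriv φ t - (∫ s in (0 : ℝ)..t, g s) * deriv φ t := by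
      funext t; simp only [Pi.sub_apply]; ring
    rw [e1, integral_sub (integrable_mul_test hf hdc hc.deriv)
      (integrable_mul_test hGl hdc hc.deriv), hw φ hφ hc, hGw φ hφ hc, sub_self])
  refine ⟨k, ?_⟩
  filter_upwards [hk] with t ht
  simp only [Pi.sub_apply] at ht
  linarith

/-- The continuous representative of a function with a weak derivative is a primitive of it. -/
theorem HasWeakDerivReal.eq_primitive {f g : ℝ → ℝ} (h : HasWeakDerivReal f g)
    (hc : Continuous f) : ∃ k : ℝ, ∀ t, f t = k + ∫ s in (0 : ℝ)..t, g s := by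
  obtain ⟨k, hk⟩ := h.ae_eq_primitive
  refine ⟨k, fun t => congrFun (g := fun t => k + ∫ s in (0 : ℝ)..t, g s) ?_ t⟩
  exact Continuous.ae_eq_iff_eq volume hc (continuous_const.add (intervalIntegral.continuous_primitive
    (intervalIntegrable_of_locallyIntegrable h.2.1) 0)) |>.1 hk

/-! ### Reduction to a classical first order system -/

/-- The first order system `u' = Q + P - c u`, `Q' = μ - g(u)` equivalent to
`u'' + c u' + g(u) = μ + P'`. -/
structure IsSystemSolution (T c μ : ℝ) (P g u Q : ℝ → ℝ) : Prop where
  periodic : Function.Periodic u T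
  hasDerivAt : ∀ t, HasDerivAt u (Q t + P t - c * u t) t
  hasDerivAt_aux : ∀ t, HasDerivAt Q (μ - g (u t)) t

theorem MemL2Period.intervalIntegrable {T : ℝ} (hT : 0 < T) {e : ℝ → ℝ}
    (he : Function.Periodic e T) (h2 : MemL2Period T e) (a b : ℝ) :
    IntervalIntegrable e volume a b := by
  refine he.intervalIntegrable₀ hT.ne' ?_ a b
  rw [intervalIntegrable_iff_integrableOn_Ioo_of_le hT.le]
  exact h2.integrable one_le_two

/-- Taking `Q = u' + c u - P` removes the rough term `e`: what remains of the equation has a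
continuous right-hand side, so `Q` is `C¹`. -/
theorem IsPositivePeriodicSolution.exists_system {T p c μ : ℝ} {e u : ℝ → ℝ}
    (hei : ∀ a b, IntervalIntegrable e volume a b)
    (h : IsPositivePeriodicSolution T p c e μ u) :
    ∃ Q, IsSystemSolution T c μ (fun t => ∫ s in (0 : ℝ)..t, e s) (fun x => 1 / x ^ p) u Q := by
  obtain ⟨u₁, u₂, h1, h2, -, -, -, heq⟩ := h.strong
  obtain ⟨k, hk⟩ := h1.eq_primitive h.continuous
  obtain ⟨a, ha⟩ := h2.ae_eq_primitive
  have i2 := intervalIntegrable_of_locallyIntegrable h2.2.1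
  set y : ℝ → ℝ := fun t => a + ∫ s in (0 : ℝ)..t, u₂ s with hy
  have hyc : Continuous y := continuous_const.add (intervalIntegral.continuous_primitive i2 0)
  have hgc : Continuous fun t => μ - 1 / u t ^ p :=
    continuous_const.sub (continuous_const.div
      (h.continuous.rpow_const fun t => Or.inl (h.pos t).ne')
      fun t => (Real.rpow_pos_of_pos (h.pos t) p).ne')
  have huy : ∀ t, u t = k + ∫ s in (0 : ℝ)..t, y s := fun t => by
    rw [hk]; congr 1
    exact intervalIntegral.integral_congr_ae (ha.mono fun s hs _ => hs)
  have hud : ∀ t, HasDerivAt u (y t) t := fun t => by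
    rw [show u = fun t => k + ∫ s in (0 : ℝ)..t, y s from funext huy]
    exact (hyc.integral_hasStrictDerivAt 0 t).hasDerivAt.const_add k
  have hyeq : ∀ t, y t = a + (∫ s in (0 : ℝ)..t, (μ - 1 / u s ^ p)) + (∫ s in (0 : ℝ)..t, e s)
      - c * (u t - k) := fun t => by
    have e1 : ∫ s in (0 : ℝ)..t, u₂ s
        = ∫ s in (0 : ℝ)..t, ((μ - 1 / u s ^ p) + e s - c * y s) := by
      apply intervalIntegral.integral_congr_ae
      filter_upwards [heq, ha] with s hs hs' _
      rw [show y s = u₁ s from hs'.symm]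
      linarith
    have ig := hgc.intervalIntegrable (μ := volume) 0 t
    have iy := (hyc.intervalIntegrable (μ := volume) 0 t).const_mul c
    simp only [hy] at *
    rw [e1, intervalIntegral.integral_sub (ig.add (hei 0 t)) iy,
      intervalIntegral.integral_add ig (hei 0 t), intervalIntegral.integral_const_mul, huy t]
    ring
  refine ⟨fun t => a + c * k + ∫ s in (0 : ℝ)..t, (μ - 1 / u s ^ p), h.periodic,
    fun t => ?_, fun t => ?_⟩
  · convert hud t using 1
    rw [hyeq t]; ring
  · exact (hgc.integral_hasStrictDerivAt 0 t).hasDerivAt.const_add _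

theorem memL2Period_of_continuous {T : ℝ} {f : ℝ → ℝ} (hf : Continuous f) :
    MemL2Period T f := by
  obtain ⟨C, hC⟩ := isCompact_Icc.exists_bound_of_continuousOn (s := Icc 0 T) hf.continuousOn
  refine MemLp.of_bound hf.aestronglyMeasurable C ?_
  filter_upwards [ae_restrict_mem measurableSet_Ioo] with t ht
  exact hC t (Ioo_subset_Icc_self ht)

theorem IsSystemSolution.isPositivePeriodicSolution {T p c μ : ℝ} {e u Q : ℝ → ℝ}
    (hei : ∀ a b, IntervalIntegrable e volume a b) (he2 : MemL2Period T e)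
    (h : IsSystemSolution T c μ (fun t => ∫ s in (0 : ℝ)..t, e s) (fun x => 1 / x ^ p) u Q)
    (hpos : ∀ t, 0 < u t) :
    IsPositivePeriodicSolution T p c e μ u := by
  have huc : Continuous u := continuous_iff_continuousAt.2 fun t => (h.hasDerivAt t).continuousAt
  have hQc : Continuous Q :=
    continuous_iff_continuousAt.2 fun t => (h.hasDerivAt_aux t).continuousAt
  have hgc : Continuous fun t => μ - 1 / u t ^ p :=
    continuous_const.sub (continuous_const.div
      (huc.rpow_const fun t => Or.inl (hpos t).ne')
      fun t => (Real.rpow_pos_of_pos (hpos t) p).ne')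
  set P : ℝ → ℝ := fun t => ∫ s in (0 : ℝ)..t, e s with hP
  have hPc : Continuous P := intervalIntegral.continuous_primitive hei 0
  have hyc : Continuous fun t => Q t + P t - c * u t :=
    (hQc.add hPc).sub (continuous_const.mul huc)
  have i2 : ∀ a b, IntervalIntegrable
      (fun t => (μ - 1 / u t ^ p) + e t - c * (Q t + P t - c * u t)) volume a b := fun a b =>
    ((hgc.intervalIntegrable a b).add (hei a b)).sub ((hyc.intervalIntegrable a b).const_mul c)
  refine ⟨huc, h.periodic, hpos, fun t => Q t + P t - c * u t,
    fun t => (μ - 1 / u t ^ p) + e t - c * (Q t + P t - c * u t), ?_, ?_, ?_, ?_, ?_, ?_⟩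
  · exact hasWeakDerivReal_of_primitive (fun a b => hyc.intervalIntegrable a b) fun a b =>
      intervalIntegral.integral_eq_sub_of_hasDerivAt (fun t _ => h.hasDerivAt t)
        (hyc.intervalIntegrable a b)
  · refine hasWeakDerivReal_of_primitive i2 fun a b => ?_
    rw [intervalIntegral.integral_sub ((hgc.intervalIntegrable a b).add (hei a b))
        ((hyc.intervalIntegrable a b).const_mul c),
      intervalIntegral.integral_add (hgc.intervalIntegrable a b) (hei a b),
      intervalIntegral.integral_const_mul,
      intervalIntegral.integral_eq_sub_of_hasDerivAt (fun t _ => h.hasDerivAt t)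
        (hyc.intervalIntegrable a b),
      intervalIntegral.integral_eq_sub_of_hasDerivAt (fun t _ => h.hasDerivAt_aux t)
        (hgc.intervalIntegrable a b),
      ← intervalIntegral.integral_interval_sub_left (hei 0 b) (hei 0 a)]
    ring
  · exact memL2Period_of_continuous huc
  · exact memL2Period_of_continuous hyc
  · have h1 := memL2Period_of_continuous (T := T) hgc
    have h2 := memL2Period_of_continuous (T := T) (hyc.const_smul c)
    exact (h1.add he2).sub h2
  · filter_upwards with t
    ring

/-! ### Comparison of solutions -/

theorem Function.Periodic.exists_forall_le {T : ℝ} (hT : 0 < T) {w : ℝ → ℝ}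
    (hw : Function.Periodic w T) (hc : Continuous w) : ∃ t₀, ∀ t, w t ≤ w t₀ := by
  obtain ⟨t₀, -, h⟩ := isCompact_Icc.exists_isMaxOn (nonempty_Icc.2 hT.le) hc.continuousOn
  refine ⟨t₀, fun t => ?_⟩
  obtain ⟨s, hs, hst⟩ := hw.exists_mem_Ico₀ hT t
  rw [hst]
  exact h (Ico_subset_Icc_self hs)

theorem Function.Periodic.exists_forall_ge {T : ℝ} (hT : 0 < T) {w : ℝ → ℝ}
    (hw : Function.Periodic w T) (hc : Continuous w) : ∃ t₀, ∀ t, w t₀ ≤ w t := by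
  have hn : Function.Periodic (fun t => - w t) T := fun t => by simp [hw t]
  obtain ⟨t₀, h⟩ := hn.exists_forall_le hT hc.neg
  exact ⟨t₀, fun t => by simpa using h t⟩

/-- If `d > 0`, the second derivative test makes `t₀` a local minimum as well, so `w` is locally
constant and `d = 0`. -/
theorem second_deriv_nonpos_of_forall_le {w y : ℝ → ℝ} {d t₀ : ℝ}
    (hw : ∀ t, HasDerivAt w (y t) t) (hy : HasDerivAt y d t₀) (hmax : ∀ t, w t ≤ w t₀) :
    d ≤ 0 := by
  by_contra! hd
  have hder : deriv w = y := funext fun t => (hw t).deriv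
  have hloc : IsLocalMax w t₀ := Eventually.of_forall hmax
  have h0 : deriv w t₀ = 0 := hloc.deriv_eq_zero
  have hmin : IsLocalMin w t₀ := isLocalMin_of_deriv_deriv_pos
    (by rw [hder, hy.deriv]; exact hd) h0 (hw t₀).continuousAt
  have hconst : w =ᶠ[𝓝 t₀] fun _ => w t₀ := by
    filter_upwards [hmin] with t ht
    exact le_antisymm (hmax t) ht
  have h2 : deriv w =ᶠ[𝓝 t₀] fun _ => 0 := by
    have := hconst.deriv
    simpa using this
  rw [hder] at h2
  have h3 : HasDerivAt y 0 t₀ := (hasDerivAt_const t₀ (0 : ℝ)).congr_of_eventuallyEq h2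
  exact hd.ne' (hy.unique h3)

namespace IsSystemSolution

variable {T c μ μ₁ μ₂ : ℝ} {P g u u₁ u₂ Q Q₁ Q₂ : ℝ → ℝ}

theorem continuous (h : IsSystemSolution T c μ P g u Q) : Continuous u :=
  continuous_iff_continuousAt.2 fun t => (h.hasDerivAt t).continuousAt

theorem continuous_aux (h : IsSystemSolution T c μ P g u Q) : Continuous Q :=
  continuous_iff_continuousAt.2 fun t => (h.hasDerivAt_aux t).continuousAt

theorem periodic_deriv (h : IsSystemSolution T c μ P g u Q) :
    Function.Periodic (fun t => Q t + P t - c * u t) T := fun t => by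
  have h1 : HasDerivAt (fun s => u (s + T)) (Q (t + T) + P (t + T) - c * u (t + T)) t :=
    (h.hasDerivAt (t + T)).comp_add_const t T
  rw [show (fun s => u (s + T)) = u from funext h.periodic] at h1
  exact h1.unique (h.hasDerivAt t)

theorem periodic_aux (h : IsSystemSolution T c μ P g u Q) (hP : Function.Periodic P T) :
    Function.Periodic Q T := fun t => by
  have h1 := h.periodic_deriv t
  simp only [hP t, h.periodic t] at h1
  linarith

/-- `P` cancels in the difference `w = u₁ - u₂`, which is therefore twice differentiable even if
neither solution is. At its maximum `w' = 0` and `w'' ≤ 0`. -/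
theorem exists_max_sub (hT : 0 < T) (h₁ : IsSystemSolution T c μ₁ P g u₁ Q₁)
    (h₂ : IsSystemSolution T c μ₂ P g u₂ Q₂) :
    ∃ t₀, (∀ t, u₁ t - u₂ t ≤ u₁ t₀ - u₂ t₀) ∧ μ₁ - μ₂ ≤ g (u₁ t₀) - g (u₂ t₀) := by
  obtain ⟨t₀, h0⟩ := (h₁.periodic.sub h₂.periodic).exists_forall_le hT
    (h₁.continuous.sub h₂.continuous)
  refine ⟨t₀, h0, ?_⟩
  have hw : ∀ t, HasDerivAt (u₁ - u₂) (Q₁ t - Q₂ t - c * (u₁ t - u₂ t)) t := fun t =>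
    ((h₁.hasDerivAt t).sub (h₂.hasDerivAt t)).congr_deriv (by ring)
  have hmax : IsLocalMax (u₁ - u₂) t₀ := Eventually.of_forall h0
  have hz := hmax.hasDerivAt_eq_zero (hw t₀)
  have hy : HasDerivAt (fun t => Q₁ t - Q₂ t - c * (u₁ t - u₂ t))
      ((μ₁ - g (u₁ t₀)) - (μ₂ - g (u₂ t₀)) - c * (Q₁ t₀ - Q₂ t₀ - c * (u₁ t₀ - u₂ t₀))) t₀ :=
    ((h₁.hasDerivAt_aux t₀).sub (h₂.hasDerivAt_aux t₀)).sub ((hw t₀).const_mul c)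
  have := second_deriv_nonpos_of_forall_le hw hy h0
  rw [hz] at this
  linarith

theorem le_of_le (hT : 0 < T) (hg : StrictAntiOn g (Ioi 0))
    (h₁ : IsSystemSolution T c μ₁ P g u₁ Q₁) (h₂ : IsSystemSolution T c μ₂ P g u₂ Q₂)
    (p₁ : ∀ t, 0 < u₁ t) (p₂ : ∀ t, 0 < u₂ t) (hμ : μ₂ ≤ μ₁) (t : ℝ) : u₁ t ≤ u₂ t := by
  obtain ⟨t₀, h0, hle⟩ := exists_max_sub hT h₁ h₂
  have : u₁ t₀ ≤ u₂ t₀ := (hg.le_iff_ge (p₂ t₀) (p₁ t₀)).1 (by linarith)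
  linarith [h0 t]

theorem eq_of_integral_eq (hT : 0 < T) (hg : StrictAntiOn g (Ioi 0))
    (h₁ : IsSystemSolution T c μ₁ P g u₁ Q₁) (h₂ : IsSystemSolution T c μ₂ P g u₂ Q₂)
    (p₁ : ∀ t, 0 < u₁ t) (p₂ : ∀ t, 0 < u₂ t)
    (hI : ∫ t in (0 : ℝ)..T, u₁ t = ∫ t in (0 : ℝ)..T, u₂ t) : u₁ = u₂ ∧ μ₁ = μ₂ := by
  wlog hμ : μ₂ ≤ μ₁ generalizing μ₁ μ₂ u₁ u₂ Q₁ Q₂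
  · have := this h₂ h₁ p₂ p₁ hI.symm (le_of_not_ge hμ)
    exact ⟨this.1.symm, this.2.symm⟩
  have hle := le_of_le hT hg h₁ h₂ p₁ p₂ hμ
  have hu : u₁ = u₂ := by
    by_contra hne
    obtain ⟨t, ht⟩ := Function.ne_iff.1 hne
    obtain ⟨s, hs, hst⟩ := (h₁.periodic.sub h₂.periodic).exists_mem_Ico₀ hT t
    simp only [Pi.sub_apply] at hst
    have hlt : u₁ s < u₂ s := by
      have := lt_of_le_of_ne (hle t) ht
      linarith
    have := intervalIntegral.integral_lt_integral_of_continuousOn_of_le_of_exists_lt hT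
      h₁.continuous.continuousOn h₂.continuous.continuousOn (fun x _ => hle x)
      ⟨s, Ico_subset_Icc_self hs, hlt⟩
    exact this.ne hI
  subst hu
  have hQ : Q₁ = Q₂ := funext fun t => by
    have := (h₁.hasDerivAt t).unique (h₂.hasDerivAt t)
    linarith
  subst hQ
  have := (h₁.hasDerivAt_aux 0).unique (h₂.hasDerivAt_aux 0)
  exact ⟨rfl, by linarith⟩

theorem exists_apply_eq (hT : 0 < T) (hP : Function.Periodic P T)
    (h : IsSystemSolution T c μ P g u Q) : ∃ t, g (u t) = μ := by
  obtain ⟨t, -, ht⟩ := exists_hasDerivAt_eq_zero hT h.continuous_aux.continuousOn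
    (by simpa using (h.periodic_aux hP 0).symm) fun t _ => h.hasDerivAt_aux t
  exact ⟨t, by linarith⟩

end IsSystemSolution

/-! ### A priori estimates -/

theorem periodic_primitive {T : ℝ} {e : ℝ → ℝ} (he : Function.Periodic e T)
    (hei : ∀ a b, IntervalIntegrable e volume a b) (hm : ∫ t in (0 : ℝ)..T, e t = 0) :
    Function.Periodic (fun t => ∫ s in (0 : ℝ)..t, e s) T := fun t => by
  simp only
  rw [← intervalIntegral.integral_add_adjacent_intervals (hei 0 t) (hei t (t + T)),
    he.intervalIntegral_add_eq t 0, zero_add, hm, add_zero]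

theorem MemL2Period.intervalIntegrable_sq {T : ℝ} (hT : 0 < T) {e : ℝ → ℝ}
    (he : Function.Periodic e T) (h2 : MemL2Period T e) (a b : ℝ) :
    IntervalIntegrable (fun t => e t ^ 2) volume a b := by
  have hp : Function.Periodic (fun t => e t ^ 2) T := fun t => by simp only [he t]
  refine hp.intervalIntegrable₀ hT.ne' ?_ a b
  rw [intervalIntegrable_iff_integrableOn_Ioo_of_le hT.le]
  exact MemLp.integrable_sq h2

/-- The `L²` bound `‖μ - g(u)‖ ≤ ‖e‖`. -/
theorem IsSystemSolution.integral_sq_le {T c μ : ℝ} {e g g' u Q : ℝ → ℝ} (hT : 0 < T)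
    (he : Function.Periodic e T) (he2 : MemL2Period T e) (hm : ∫ t in (0 : ℝ)..T, e t = 0)
    (h : IsSystemSolution T c μ (fun t => ∫ s in (0 : ℝ)..t, e s) g u Q)
    (hg : ∀ t, HasDerivAt g (g' (u t)) (u t)) (hg' : ContinuousOn g' (range u))
    (hneg : ∀ t, g' (u t) ≤ 0) :
    ∫ t in (0 : ℝ)..T, (μ - g (u t)) ^ 2 ≤ ∫ t in (0 : ℝ)..T, e t ^ 2 := by
  have hei := he2.intervalIntegrable hT he
  have hesq := he2.intervalIntegrable_sq hT he
  have hPp := periodic_primitive he hei hm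
  set P : ℝ → ℝ := fun t => ∫ s in (0 : ℝ)..t, e s with hP
  have hPc : Continuous P := intervalIntegral.continuous_primitive hei 0
  have huc := h.continuous
  have hQc := h.continuous_aux
  have hQp := h.periodic_aux hPp
  have hgc : Continuous fun t => g (u t) := continuous_iff_continuousAt.2 fun t =>
    (hg t).continuousAt.comp huc.continuousAt
  have hg'c : Continuous fun t => g' (u t) := hg'.comp_continuous huc fun t => mem_range_self t
  set y : ℝ → ℝ := fun t => Q t + P t - c * u t with hy
  have hyc : Continuous y := (hQc.add hPc).sub (continuous_const.mul huc)
  have hqc : Continuous fun t => μ - g (u t) := continuous_const.sub hgc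
  have hq : ∀ t, HasDerivAt (fun t => μ - g (u t)) (-(g' (u t) * y t)) t := fun t =>
    ((hg t).comp t (h.hasDerivAt t)).const_sub μ
  have hf : ∀ a b, IntervalIntegrable (fun t => (μ - g (u t)) + e t) volume a b := fun a b =>
    (hqc.intervalIntegrable a b).add (hei a b)
  have hF : ∀ a b, ∫ t in a..b, ((μ - g (u t)) + e t)
      = (fun t => Q t + P t) b - (fun t => Q t + P t) a := fun a b => by
    rw [intervalIntegral.integral_add (hqc.intervalIntegrable a b) (hei a b),
      intervalIntegral.integral_eq_sub_of_hasDerivAt (fun t _ => h.hasDerivAt_aux t)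
        (hqc.intervalIntegrable a b),
      ← intervalIntegral.integral_interval_sub_left (hei 0 b) (hei 0 a)]
    simp only [hP]; ring
  have key := integral_primitive_mul_deriv hf hF hq (hg'c.mul hyc).neg 0 T
  -- The damping contribution is the derivative of a function of `u`, so it integrates to zero over
  -- a period.
  have e1 : ∫ t in (0 : ℝ)..T, u t * g' (u t) * y t = 0 := by
    have := intervalIntegral.integral_comp_mul_deriv' (a := 0) (b := T) (f := u) (f' := y)
      (g := fun x => x * g' x) (fun t _ => h.hasDerivAt t) hyc.continuousOn
      ((continuousOn_id.mul hg').mono (image_subset_range _ _))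
    rw [show u T = u 0 by simpa using h.periodic 0, intervalIntegral.integral_same] at this
    exact this
  have e2 : ∫ t in (0 : ℝ)..T, (Q t + P t) * -(g' (u t) * y t)
      = (∫ t in (0 : ℝ)..T, y t ^ 2 * -g' (u t)) := by
    have : (fun t => (Q t + P t) * -(g' (u t) * y t))
        = fun t => y t ^ 2 * -g' (u t) - c * (u t * g' (u t) * y t) := by
      funext t; simp only [hy]; ring
    have j1 : IntervalIntegrable (fun t => y t ^ 2 * -g' (u t)) volume 0 T :=
      ((hyc.pow 2).mul hg'c.neg).intervalIntegrable 0 T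
    have j2 : IntervalIntegrable (fun t => u t * g' (u t) * y t) volume 0 T :=
      ((huc.mul hg'c).mul hyc).intervalIntegrable 0 T
    rw [this, intervalIntegral.integral_sub j1 (j2.const_mul c),
      intervalIntegral.integral_const_mul, e1]
    ring
  have e3 : 0 ≤ ∫ t in (0 : ℝ)..T, y t ^ 2 * -g' (u t) :=
    intervalIntegral.integral_nonneg hT.le fun t _ =>
      mul_nonneg (sq_nonneg _) (neg_nonneg.2 (hneg t))
  have hQT : Q T = Q 0 := by simpa using hQp 0
  have hPT : P T = P 0 := by simpa using hPp 0
  have huT : u T = u 0 := by simpa using h.periodic 0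
  simp only [hQT, hPT, huT, sub_self, zero_sub] at key
  rw [e2] at key
  have i1 : IntervalIntegrable (fun t => ((μ - g (u t)) + e t) * (μ - g (u t))) volume 0 T :=
    (hf 0 T).mul_continuousOn hqc.continuousOn
  have i2 : IntervalIntegrable (fun t => (μ - g (u t)) ^ 2) volume 0 T :=
      (hqc.pow 2).intervalIntegrable 0 T
  -- With `q = μ - g(u)`, the pointwise inequality `q² - e² ≤ 2 (q + e) q` is `(q + e)² ≥ 0`.
  have e4 : ∫ t in (0 : ℝ)..T, ((μ - g (u t)) ^ 2 - e t ^ 2)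
      ≤ ∫ t in (0 : ℝ)..T, 2 * (((μ - g (u t)) + e t) * (μ - g (u t))) :=
    intervalIntegral.integral_mono_on hT.le (i2.sub (hesq 0 T)) (i1.const_mul 2) fun t _ => by
      nlinarith [sq_nonneg (μ - g (u t) + e t)]
  rw [intervalIntegral.integral_sub i2 (hesq 0 T), intervalIntegral.integral_const_mul] at e4
  linarith

/-- Cauchy–Schwarz against the constant `1`, read off from the nonnegativity of the variance of `f`.
-/
theorem sq_integral_le {f : ℝ → ℝ} {a b : ℝ} (hab : a ≤ b)
    (hf : IntervalIntegrable f volume a b)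
    (hf2 : IntervalIntegrable (fun t => f t ^ 2) volume a b) :
    (∫ t in a..b, f t) ^ 2 ≤ (b - a) * ∫ t in a..b, f t ^ 2 := by
  rcases hab.eq_or_lt with rfl | hlt
  · simp
  set m := (∫ t in a..b, f t) / (b - a) with hm
  have hL : 0 < b - a := sub_pos.2 hlt
  have h0 : 0 ≤ ∫ t in a..b, (f t - m) ^ 2 :=
    intervalIntegral.integral_nonneg hab fun t _ => sq_nonneg _
  have h1 : ∫ t in a..b, (f t - m) ^ 2
      = (∫ t in a..b, f t ^ 2) - 2 * m * (∫ t in a..b, f t) + (b - a) * m ^ 2 := by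
    have : (fun t => (f t - m) ^ 2) = fun t => (f t ^ 2 - 2 * m * f t) + m ^ 2 := by
      funext t; ring
    rw [this, intervalIntegral.integral_add (hf2.sub (hf.const_mul _)) (by simp),
      intervalIntegral.integral_sub hf2 (hf.const_mul _), intervalIntegral.integral_const_mul]
    simp
  have h2 : ∫ t in a..b, f t = m * (b - a) := by rw [hm]; field_simp
  rw [h1, h2] at h0
  rw [h2]
  nlinarith

/-- Oscillation bounds depending only on `T`, `c` and `e`. -/
theorem exists_apriori_bound {T : ℝ} (c : ℝ) {e : ℝ → ℝ} (hT : 0 < T)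
    (he : Function.Periodic e T) (he2 : MemL2Period T e) (hm : ∫ t in (0 : ℝ)..T, e t = 0) :
    ∃ K, 0 < K ∧ ∀ (μ : ℝ) (g u Q : ℝ → ℝ),
      IsSystemSolution T c μ (fun t => ∫ s in (0 : ℝ)..t, e s) g u Q →
      Continuous (fun t => g (u t)) →
      ∫ t in (0 : ℝ)..T, (μ - g (u t)) ^ 2 ≤ ∫ t in (0 : ℝ)..T, e t ^ 2 →
      (∀ s t, u t ≤ u s + K) ∧
      ∃ t₀, (∀ t, u t₀ ≤ u t) ∧
        ∀ s ∈ Icc 0 T, u (t₀ + s) ≤ u t₀ + K * (s * √s) := by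
  have hei := he2.intervalIntegrable hT he
  have hesq := he2.intervalIntegrable_sq hT he
  have hPp := periodic_primitive he hei hm
  set P : ℝ → ℝ := fun t => ∫ s in (0 : ℝ)..t, e s with hP
  set N := ∫ t in (0 : ℝ)..T, e t ^ 2 with hN
  have hN0 : 0 ≤ N := intervalIntegral.integral_nonneg hT.le fun t _ => sq_nonneg _
  set B := 2 * √N with hB
  have hB0 : 0 ≤ B := by positivity
  set Y := 2 * (B * √T) with hY
  have hY0 : 0 ≤ Y := by positivity
  -- `Y` will bound `|u'|`, so `Y * T` controls the oscillation; the last summand controls the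
  -- `s^(3/2)` growth, and the `1` makes the constant positive.
  refine ⟨1 + Y * T + (B + |c| * Y * √T), by positivity, ?_⟩
  intro μ g u Q h hgc hqN
  have huc := h.continuous
  have hQp := h.periodic_aux hPp
  have hqc : Continuous fun t => μ - g (u t) := continuous_const.sub hgc
  set y : ℝ → ℝ := fun t => Q t + P t - c * u t with hy
  have hfi : ∀ a b, IntervalIntegrable (fun t => (μ - g (u t)) + e t) volume a b := fun a b =>
    (hqc.intervalIntegrable a b).add (hei a b)
  have hfsq : ∀ a b, IntervalIntegrable (fun t => ((μ - g (u t)) + e t) ^ 2) volume a b :=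
    fun a b => by
      have : (fun t => ((μ - g (u t)) + e t) ^ 2)
        = fun t => (μ - g (u t)) ^ 2 + 2 * ((μ - g (u t)) * e t) + e t ^ 2 := by
        funext t; ring
      rw [this]
      exact (((hqc.pow 2).intervalIntegrable a b).add
        (((hei a b).continuousOn_mul hqc.continuousOn).const_mul 2)).add (hesq a b)
  have hfper : Function.Periodic (fun t => ((μ - g (u t)) + e t) ^ 2) T := fun t => by
    simp only [he t, h.periodic t]
  have hfN : ∫ t in (0 : ℝ)..T, ((μ - g (u t)) + e t) ^ 2 ≤ 4 * N := by
    have i2 : IntervalIntegrable (fun t => (μ - g (u t)) ^ 2) volume 0 T :=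
      (hqc.pow 2).intervalIntegrable 0 T
    have : ∫ t in (0 : ℝ)..T, ((μ - g (u t)) + e t) ^ 2
        ≤ ∫ t in (0 : ℝ)..T, (2 * (μ - g (u t)) ^ 2 + 2 * e t ^ 2) :=
      intervalIntegral.integral_mono_on hT.le (hfsq 0 T)
        ((i2.const_mul 2).add ((hesq 0 T).const_mul 2)) fun t _ => by
        nlinarith [sq_nonneg (μ - g (u t) - e t)]
    rw [intervalIntegral.integral_add (i2.const_mul 2) ((hesq 0 T).const_mul 2),
      intervalIntegral.integral_const_mul, intervalIntegral.integral_const_mul] at this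
    linarith
  have hF : ∀ a b, ∫ t in a..b, ((μ - g (u t)) + e t) = (Q b + P b) - (Q a + P a) := fun a b => by
    rw [intervalIntegral.integral_add (hqc.intervalIntegrable a b) (hei a b),
      intervalIntegral.integral_eq_sub_of_hasDerivAt (fun t _ => h.hasDerivAt_aux t)
        (hqc.intervalIntegrable a b),
      ← intervalIntegral.integral_interval_sub_left (hei 0 b) (hei 0 a)]
    simp only [hP]; ring
  have hR : ∀ a s, 0 ≤ s → s ≤ T → |(Q (a + s) + P (a + s)) - (Q a + P a)| ≤ B * √s := by
    intro a s hs0 hsT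
    rw [← hF]
    have h1 := sq_integral_le (by linarith : a ≤ a + s) (hfi a (a + s)) (hfsq a (a + s))
    have h2 : ∫ t in a..(a + s), ((μ - g (u t)) + e t) ^ 2 ≤ 4 * N := by
      refine le_trans ?_ hfN
      have := hfper.intervalIntegral_add_eq 0 a
      rw [zero_add] at this
      rw [this]
      exact intervalIntegral.integral_mono_interval le_rfl (by linarith) (by linarith)
        (Eventually.of_forall fun t => sq_nonneg _) (hfsq a (a + T))
    apply abs_le_of_sq_le_sq _ (by positivity)
    rw [hB, mul_pow, mul_pow, Real.sq_sqrt hN0, Real.sq_sqrt hs0]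
    have h3 : (a + s - a) * ∫ t in a..(a + s), ((μ - g (u t)) + e t) ^ 2 ≤ s * (4 * N) := by
      rw [add_sub_cancel_left]; gcongr
    linarith
  have hRT : ∀ a b, |(Q b + P b) - (Q a + P a)| ≤ B * √T := by
    intro a b
    obtain ⟨b', hb', hbb⟩ := (hQp.add hPp).exists_mem_Ico hT b a
    simp only [Pi.add_apply] at hbb
    rw [hbb]
    have := hR a (b' - a) (by linarith [hb'.1]) (by linarith [hb'.2])
    rw [add_sub_cancel] at this
    exact this.trans (by gcongr; linarith [hb'.2])
  obtain ⟨tM, hM⟩ := h.periodic.exists_forall_le hT huc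
  obtain ⟨t₀, h0⟩ := h.periodic.exists_forall_ge hT huc
  have hyM : y tM = 0 :=
    IsLocalMax.hasDerivAt_eq_zero (Eventually.of_forall hM) (h.hasDerivAt tM)
  have hy0 : y t₀ = 0 :=
    IsLocalMin.hasDerivAt_eq_zero (Eventually.of_forall h0) (h.hasDerivAt t₀)
  -- Since `u'` vanishes at both extrema, the increment of `Q + P` between them is exactly `c` times
  -- the oscillation of `u`.
  have hcu : ∀ t, |c * (u t - u t₀)| ≤ B * √T := fun t => by
    have h1 := hRT t₀ tM
    have h2 : (Q tM + P tM) - (Q t₀ + P t₀) = c * (u tM - u t₀) := by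
      simp only [hy] at hyM hy0
      linarith
    rw [h2, abs_mul] at h1
    rw [abs_mul]
    refine le_trans (mul_le_mul_of_nonneg_left ?_ (abs_nonneg c)) h1
    rw [abs_of_nonneg (sub_nonneg.2 (h0 t)), abs_of_nonneg (sub_nonneg.2 (h0 tM))]
    linarith [hM t]
  have hyB : ∀ t, |y t| ≤ Y := fun t => by
    have h1 : y t = ((Q t + P t) - (Q t₀ + P t₀)) - c * (u t - u t₀) := by
      have := hy0
      simp only [hy] at this ⊢
      linarith
    rw [h1, hY]
    have h2 := abs_le.1 (hRT t₀ t)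
    have h3 := abs_le.1 (hcu t)
    exact abs_le.2 ⟨by linarith [h2.1, h3.2], by linarith [h2.2, h3.1]⟩
  have hgrow : ∀ s, 0 ≤ s → ∀ C, (∀ r ∈ Icc 0 s, y (t₀ + r) ≤ C) →
      u (t₀ + s) ≤ u t₀ + C * s := by
    intro s hs C hC
    have := (convex_Icc t₀ (t₀ + s)).image_sub_le_mul_sub_of_deriv_le huc.continuousOn
      (fun t _ => (h.hasDerivAt t).differentiableAt.differentiableWithinAt)
      (C := C) (fun t ht => by
        rw [(h.hasDerivAt t).deriv]
        rw [interior_Icc] at ht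
        have := hC (t - t₀) ⟨by linarith [ht.1], by linarith [ht.2]⟩
        rw [add_sub_cancel] at this
        exact this) t₀ (left_mem_Icc.2 (by linarith)) (t₀ + s) (right_mem_Icc.2 (by linarith))
      (by linarith)
    rw [add_sub_cancel_left] at this
    linarith
  have hosc : ∀ s, 0 ≤ s → u (t₀ + s) ≤ u t₀ + Y * s := fun s hs =>
    hgrow s hs Y fun r _ => (le_abs_self _).trans (hyB _)
  have hextra : 0 ≤ B + |c| * Y * √T := by positivity
  refine ⟨fun s t => ?_, t₀, h0, fun s hs => ?_⟩
  · obtain ⟨t', ht', htt⟩ := h.periodic.exists_mem_Ico hT t t₀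
    rw [htt]
    have h1 := hosc (t' - t₀) (by linarith [ht'.1])
    rw [add_sub_cancel] at h1
    have h2 : Y * (t' - t₀) ≤ Y * T := by
      gcongr; linarith [ht'.2]
    linarith [h0 s]
  · have h1 := hgrow s hs.1 ((B + |c| * Y * √T) * √s) fun r hr => by
      have hrT : r ≤ T := hr.2.trans hs.2
      have h2 : y (t₀ + r) = ((Q (t₀ + r) + P (t₀ + r)) - (Q t₀ + P t₀))
          - c * (u (t₀ + r) - u t₀) := by
        have := hy0
        simp only [hy] at this ⊢
        linarith
      have h3 : |c * (u (t₀ + r) - u t₀)| ≤ |c| * (Y * r) := by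
        rw [abs_mul, abs_of_nonneg (sub_nonneg.2 (h0 _))]
        gcongr
        linarith [hosc r hr.1]
      have h4 := (abs_le.1 (hR t₀ r hr.1 hrT)).2
      have h5 := (abs_le.1 h3).1
      have h6 : √r ≤ √s := Real.sqrt_le_sqrt hr.2
      have h7 : r ≤ √T * √s := by
        calc r = √r * √r := (Real.mul_self_sqrt hr.1).symm
          _ ≤ _ := by gcongr
      calc y (t₀ + r) ≤ B * √r + |c| * (Y * r) := by rw [h2]; linarith
        _ ≤ B * √s + |c| * (Y * (√T * √s)) := by gcongr
        _ = _ := by ring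
    have h2 : (B + |c| * Y * √T) * √s * s ≤ (1 + Y * T + (B + |c| * Y * √T)) * (s * √s) := by
      have : 0 ≤ (1 + Y * T) * (s * √s) := by
        have := hs.1
        positivity
      nlinarith
    linarith

/-! ### Periodic solutions of linear first order equations -/

/-- The solution is the periodic Green formula: `exp(r t)` times the integral of `exp(-r s) k(s)`
over `[t, t + T]`, divided by `exp(-r T) - 1`. -/
theorem exists_periodic_linear {T r : ℝ} (hT : 0 < T) (hr : r ≠ 0) {k : ℝ → ℝ}
    (hk : Function.Periodic k T) (hkc : Continuous k) :
    ∃ y : ℝ → ℝ, Function.Periodic y T ∧ ∀ t, HasDerivAt y (r * y t + k t) t := by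
  set E := Real.exp (-(r * T)) with hE
  have hE1 : E - 1 ≠ 0 := by
    rw [sub_ne_zero, hE]
    intro h
    rw [Real.exp_eq_one_iff, neg_eq_zero] at h
    exact mul_ne_zero hr hT.ne' h
  set h : ℝ → ℝ := fun s => Real.exp (-(r * s)) * k s with hh
  have hc : Continuous h := by fun_prop
  have hshift : ∀ s, h (s + T) = E * h s := fun s => by
    simp only [hh, hE, hk s]
    rw [← mul_assoc, ← Real.exp_add]
    ring_nf
  set H : ℝ → ℝ := fun t => ∫ s in (0 : ℝ)..t, h s with hH
  have hHd : ∀ t, HasDerivAt H (h t) t := fun t => (hc.integral_hasStrictDerivAt 0 t).hasDerivAt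
  have hsub : ∀ a b, ∫ s in a..b, h s = H b - H a := fun a b =>
    (intervalIntegral.integral_interval_sub_left (hc.intervalIntegrable 0 b)
      (hc.intervalIntegrable 0 a)).symm
  refine ⟨fun t => Real.exp (r * t) * ((H (t + T) - H t) / (E - 1)), fun t => ?_, fun t => ?_⟩
  · have h1 : H (t + T + T) - H (t + T) = E * (H (t + T) - H t) := by
      rw [← hsub, ← hsub, ← intervalIntegral.integral_comp_add_right,
        ← intervalIntegral.integral_const_mul]
      exact intervalIntegral.integral_congr fun s _ => hshift s
    simp only
    rw [h1, mul_add, Real.exp_add, show Real.exp (r * T) = E⁻¹ by rw [hE, Real.exp_neg, inv_inv]]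
    have hE0 : E ≠ 0 := (Real.exp_pos _).ne'
    field_simp
  · have h1 : HasDerivAt (fun t => (H (t + T) - H t) / (E - 1)) (Real.exp (-(r * t)) * k t) t := by
      refine ((((hHd (t + T)).comp_add_const t T).sub (hHd t)).div_const _).congr_deriv ?_
      rw [hshift]
      simp only [hh]
      field_simp
    have h2 : HasDerivAt (fun t => Real.exp (r * t)) (Real.exp (r * t) * (r * 1)) t :=
      ((hasDerivAt_id t).const_mul r).exp
    refine (h2.mul h1).congr_deriv ?_
    have h3 : Real.exp (r * t) * Real.exp (-(r * t)) = 1 := by rw [← Real.exp_add]; simp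
    calc _ = r * (Real.exp (r * t) * ((H (t + T) - H t) / (E - 1)))
          + (Real.exp (r * t) * Real.exp (-(r * t))) * k t := by ring
      _ = _ := by rw [h3]; ring

/-- At the extrema of `y` the derivative vanishes, so `r y = -k` there. -/
theorem periodic_linear_bound {T r B : ℝ} (hT : 0 < T) (hr : r ≠ 0) {y k : ℝ → ℝ}
    (hy : Function.Periodic y T) (hd : ∀ t, HasDerivAt y (r * y t + k t) t)
    (hB : ∀ t, |k t| ≤ B) (t : ℝ) : |y t| ≤ B / |r| := by
  have hc : Continuous y := continuous_iff_continuousAt.2 fun t => (hd t).continuousAt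
  have hval : ∀ s, r * y s + k s = 0 → |y s| ≤ B / |r| := fun s hs => by
    rw [le_div_iff₀ (abs_pos.2 hr), ← abs_mul, show y s * r = -k s by linarith, abs_neg]
    exact hB s
  obtain ⟨tM, hM⟩ := hy.exists_forall_le hT hc
  obtain ⟨tm, hm⟩ := hy.exists_forall_ge hT hc
  have h1 := hval tM (IsLocalMax.hasDerivAt_eq_zero (Eventually.of_forall hM) (hd tM))
  have h2 := hval tm (IsLocalMin.hasDerivAt_eq_zero (Eventually.of_forall hm) (hd tm))
  exact abs_le.2 ⟨(abs_le.1 h2).1.trans (hm t), (hM t).trans (abs_le.1 h1).2⟩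

/-! ### Existence for strictly monotone Lipschitz nonlinearities -/

theorem Function.Periodic.exists_abs_le {T : ℝ} (hT : 0 < T) {w : ℝ → ℝ}
    (hw : Function.Periodic w T) (hc : Continuous w) : ∃ C, ∀ t, |w t| ≤ C := by
  have h : Function.Periodic (fun t => |w t|) T := fun t => by simp only [hw t]
  obtain ⟨t₀, h0⟩ := h.exists_forall_le hT hc.abs
  exact ⟨_, h0⟩

/-- Rewrite the equation as `u'' + c u' - l u = μ - g(u) - l u + P'`. The left side factors with
real roots `r₁`, `r₂` satisfying `r₁ r₂ = -l`, so its periodic inverse has sup-norm bound `1 / l`.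
The map `x ↦ -g(x) - l x` has Lipschitz constant `l - m`, so iteration contracts with factor `(l -
m) / l`. -/
theorem exists_system_of_lipschitz {T c μ m l : ℝ} {P g : ℝ → ℝ} (hT : 0 < T)
    (hP : Function.Periodic P T) (hPc : Continuous P) (hm : 0 < m) (hml : m ≤ l)
    (hg : Continuous g)
    (hlow : ∀ x y, x ≤ y → m * (y - x) ≤ g x - g y)
    (hupp : ∀ x y, x ≤ y → g x - g y ≤ l * (y - x)) :
    ∃ u Q, IsSystemSolution T c μ P g u Q := by
  have hl : 0 < l := hm.trans_le hml
  set d := √(c ^ 2 + 4 * l) with hd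
  have hd2 : d ^ 2 = c ^ 2 + 4 * l := Real.sq_sqrt (by positivity)
  set r₁ := (-c + d) / 2 with hr₁
  set r₂ := (-c - d) / 2 with hr₂
  have hsum : r₁ + r₂ = -c := by rw [hr₁, hr₂]; ring
  have hprod : r₁ * r₂ = -l := by
    rw [hr₁, hr₂]; linear_combination (-1 / 4 : ℝ) * hd2
  have hr₁0 : r₁ ≠ 0 := fun h => by rw [h, zero_mul] at hprod; linarith
  have hr₂0 : r₂ ≠ 0 := fun h => by rw [h, mul_zero] at hprod; linarith
  have habs : |r₁| * |r₂| = l := by rw [← abs_mul, hprod, abs_neg, abs_of_pos hl]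
  let s : Set (BoundedContinuousFunction ℝ ℝ) := {f | Function.Periodic f T}
  have hs : IsClosed s := by
    have : s = ⋂ t, {f : BoundedContinuousFunction ℝ ℝ | f (t + T) = f t} := by
      ext f; simp [s, Function.Periodic]
    rw [this]
    exact isClosed_iInter fun t => isClosed_eq
      (BoundedContinuousFunction.lipschitz_eval_const (t + T)).continuous
      (BoundedContinuousFunction.lipschitz_eval_const t).continuous
  have : CompleteSpace s := hs.completeSpace_coe
  have : Nonempty s := ⟨⟨0, fun t => rfl⟩⟩
  -- Here `z + P` plays the role of `u' - r₂ u`. Solving for `z` itself turns the forcing `P'` into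
  -- `r₁ P`, so `P` need only be continuous.
  have step : ∀ v : s, ∃ u : s, ∃ z : ℝ → ℝ, Function.Periodic z T ∧
      (∀ t, HasDerivAt z (r₁ * z t + (μ - g (v.1 t) - l * v.1 t + r₁ * P t)) t) ∧
      (∀ t, HasDerivAt u.1 (r₂ * u.1 t + (z t + P t)) t) := by
    rintro ⟨v, hv⟩
    have hk : Function.Periodic (fun t => μ - g (v t) - l * v t + r₁ * P t) T := fun t => by
      simp only [hv t, hP t]
    have hkc : Continuous (fun t => μ - g (v t) - l * v t + r₁ * P t) :=
      ((continuous_const.sub (hg.comp v.continuous)).sub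
        (continuous_const.mul v.continuous)).add (continuous_const.mul hPc)
    obtain ⟨z, hz, hzd⟩ := exists_periodic_linear hT hr₁0 hk hkc
    have hzc : Continuous z := continuous_iff_continuousAt.2 fun t => (hzd t).continuousAt
    obtain ⟨u, hu, hud⟩ := exists_periodic_linear hT hr₂0 (hz.add hP) (hzc.add hPc)
    have huc : Continuous u := continuous_iff_continuousAt.2 fun t => (hud t).continuousAt
    obtain ⟨C, hC⟩ := hu.exists_abs_le hT huc
    exact ⟨⟨BoundedContinuousFunction.ofNormedAddCommGroup u huc C hC, hu⟩, z, hz, hzd, hud⟩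
  choose Φ z hzp hzd hΦd using step
  have hK0 : 0 ≤ (l - m) / l := div_nonneg (by linarith) hl.le
  have hcontr : ContractingWith (Real.toNNReal ((l - m) / l)) Φ := by
    refine ⟨?_, ?_⟩
    · rw [Real.toNNReal_lt_one, div_lt_one hl]; linarith
    refine LipschitzWith.of_dist_le_mul fun v w => ?_
    rw [Real.coe_toNNReal _ hK0]
    change dist (Φ v).1 (Φ w).1 ≤ (l - m) / l * dist v.1 w.1
    rw [BoundedContinuousFunction.dist_le (by positivity)]
    intro t
    have hb : ∀ t, |(μ - g (v.1 t) - l * v.1 t + r₁ * P t)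
        - (μ - g (w.1 t) - l * w.1 t + r₁ * P t)| ≤ (l - m) * dist v.1 w.1 := fun t => by
      have h1 : |v.1 t - w.1 t| ≤ dist v.1 w.1 :=
        BoundedContinuousFunction.dist_coe_le_dist (f := v.1) (g := w.1) t
      refine le_trans ?_ (mul_le_mul_of_nonneg_left h1 (by linarith))
      rcases le_total (v.1 t) (w.1 t) with h | h
      · rw [abs_of_nonpos (sub_nonpos.2 h), abs_le]
        constructor <;> nlinarith [hlow _ _ h, hupp _ _ h]
      · rw [abs_of_nonneg (sub_nonneg.2 h), abs_le]
        constructor <;> nlinarith [hlow _ _ h, hupp _ _ h]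
    have hz1 := periodic_linear_bound hT hr₁0 ((hzp v).sub (hzp w))
      (fun t => ((hzd v t).sub (hzd w t)).congr_deriv
        (by simp only [Pi.sub_apply]; ring)) hb
    have hu1 := periodic_linear_bound (k := fun t => z v t - z w t) hT hr₂0
      (y := fun t => (Φ v).1 t - (Φ w).1 t)
      (fun t => by simp only [(Φ v).2 t, (Φ w).2 t])
      (fun t => ((hΦd v t).sub (hΦd w t)).congr_deriv (by ring)) hz1 t
    rw [Real.dist_eq]
    refine hu1.trans (le_of_eq ?_)
    rw [div_div, habs]
    ring
  obtain ⟨u, hu⟩ : ∃ u, Φ u = u := ⟨_, hcontr.fixedPoint_isFixedPt⟩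
  have hzd' := hzd u
  have hud' := hΦd u
  rw [hu] at hud'
  refine ⟨u.1, fun t => z u t - r₁ * u.1 t, u.2, fun t => (hud' t).congr_deriv ?_, fun t =>
    ((hzd' t).sub ((hud' t).const_mul r₁)).congr_deriv ?_⟩
  · linear_combination u.1 t * hsum
  · linear_combination (-u.1 t) * hprod

/-! ### Truncation of the singular nonlinearity -/

theorem hasDerivAt_one_div_rpow (p : ℝ) {x : ℝ} (hx : 0 < x) :
    HasDerivAt (fun x : ℝ => 1 / x ^ p) (-(p * x ^ (-p - 1))) x := by
  have h := Real.hasDerivAt_rpow_const (p := -p) (Or.inl hx.ne')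
  refine (h.congr_of_eventuallyEq ?_).congr_deriv (by ring)
  filter_upwards [Ioi_mem_nhds hx] with y hy
  rw [Real.rpow_neg (le_of_lt hy), one_div]

theorem strictAntiOn_one_div_rpow {p : ℝ} (hp : 0 < p) :
    StrictAntiOn (fun x : ℝ => 1 / x ^ p) (Ioi 0) := fun _ hx _ _ hxy =>
  one_div_lt_one_div_of_lt (Real.rpow_pos_of_pos hx p) (Real.rpow_lt_rpow (le_of_lt hx) hxy hp)

/-- The derivative of the power is frozen outside `[δ, M]` and integrated back, which extends the
function linearly and keeps it `C¹` with slopes between `-l` and `-m`. -/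
theorem exists_truncation {p δ M : ℝ} (hp : 0 < p) (hδ : 0 < δ) (hM : δ ≤ M) :
    ∃ (g g' : ℝ → ℝ) (m l : ℝ), (∀ x, HasDerivAt g (g' x) x) ∧ Continuous g' ∧
      (∀ x, g' x ≤ 0) ∧ 0 < m ∧ m ≤ l ∧ (∀ x y, x ≤ y → m * (y - x) ≤ g x - g y) ∧
      (∀ x y, x ≤ y → g x - g y ≤ l * (y - x)) ∧ ∀ x ∈ Icc δ M, g x = 1 / x ^ p := by
  have hM0 : 0 < M := hδ.trans_le hM
  set κ : ℝ → ℝ := fun s => max δ (min s M) with hκ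
  have hκδ : ∀ s, δ ≤ κ s := fun s => le_max_left _ _
  have hκM : ∀ s, κ s ≤ M := fun s => max_le hM (min_le_right _ _)
  have hκ0 : ∀ s, 0 < κ s := fun s => hδ.trans_le (hκδ s)
  have hκid : ∀ s ∈ Icc δ M, κ s = s := fun s hs => by
    simp only [hκ]; rw [min_eq_left hs.2, max_eq_right hs.1]
  have hκc : Continuous κ := continuous_const.max (continuous_id.min continuous_const)
  set a : ℝ → ℝ := fun s => p * κ s ^ (-p - 1) with ha
  have hac : Continuous a :=
    continuous_const.mul (hκc.rpow_const fun s => Or.inl (hκ0 s).ne')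
  have hpow : ∀ {x y : ℝ}, 0 < x → x ≤ y → p * y ^ (-p - 1) ≤ p * x ^ (-p - 1) :=
    fun hx hxy => mul_le_mul_of_nonneg_left
      (Real.rpow_le_rpow_of_nonpos hx hxy (by linarith)) hp.le
  have haM : ∀ s, p * M ^ (-p - 1) ≤ a s := fun s => hpow (hκ0 s) (hκM s)
  have haδ : ∀ s, a s ≤ p * δ ^ (-p - 1) := fun s => hpow hδ (hκδ s)
  have hdiff : ∀ x y, (1 / δ ^ p - ∫ s in δ..x, a s) - (1 / δ ^ p - ∫ s in δ..y, a s)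
      = ∫ s in x..y, a s := fun x y => by
    rw [← intervalIntegral.integral_interval_sub_left (hac.intervalIntegrable δ y)
      (hac.intervalIntegrable δ x)]
    ring
  refine ⟨fun x => 1 / δ ^ p - ∫ s in δ..x, a s, fun x => -a x, p * M ^ (-p - 1),
    p * δ ^ (-p - 1), fun x => (hac.integral_hasStrictDerivAt δ x).hasDerivAt.const_sub _,
    hac.neg, fun x => ?_, by positivity, hpow hδ hM, fun x y hxy => ?_, fun x y hxy => ?_,
    fun x hx => ?_⟩
  · have : 0 ≤ a x := mul_nonneg hp.le (Real.rpow_nonneg (hκ0 x).le _)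
    linarith
  · rw [hdiff]
    have := intervalIntegral.integral_mono_on (μ := volume) hxy
      (f := fun _ => p * M ^ (-p - 1)) (by simp) (hac.intervalIntegrable x y) fun s _ => haM s
    rw [intervalIntegral.integral_const, smul_eq_mul] at this
    linarith
  · rw [hdiff]
    have := intervalIntegral.integral_mono_on (μ := volume) hxy
      (g := fun _ => p * δ ^ (-p - 1)) (hac.intervalIntegrable x y) (by simp) fun s _ => haδ s
    rw [intervalIntegral.integral_const, smul_eq_mul] at this
    linarith
  · have h1 : ∫ s in δ..x, -a s = 1 / x ^ p - 1 / δ ^ p := by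
      refine intervalIntegral.integral_eq_sub_of_hasDerivAt (f := fun x : ℝ => 1 / x ^ p)
        (fun s hs => ?_) (hac.neg.intervalIntegrable δ x)
      rw [uIcc_of_le hx.1] at hs
      have := hasDerivAt_one_div_rpow p (hδ.trans_le hs.1)
      simp only [ha]
      rwa [hκid s ⟨hs.1, hs.2.trans hx.2⟩]
    rw [intervalIntegral.integral_neg] at h1
    simp only
    linarith

/-! ### Existence for the singular problem -/

/-- This is where `p ≥ 1/3` is decisive: `s^(3p) ≤ s` on `(0, 1]`, so the squared singularity along
`s^(3/2)` is at least of order `1/s`. -/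
theorem le_one_div_rpow_sq {p L s : ℝ} (hp : 1 / 3 ≤ p) (hL : 0 < L) (hs : 0 < s) (hs1 : s ≤ 1) :
    (1 / L ^ p) ^ 2 * s⁻¹ ≤ (1 / (L * (s * √s)) ^ p) ^ 2 := by
  have hq : 0 < √s := Real.sqrt_pos.2 hs
  have h1 : ((s * √s) ^ p) ^ 2 ≤ s := by
    have h2 : s * √s = s ^ (3 / 2 : ℝ) := by
      rw [Real.sqrt_eq_rpow, ← Real.rpow_one_add' hs.le (by norm_num)]; norm_num
    rw [h2, ← Real.rpow_mul hs.le, ← Real.rpow_natCast, ← Real.rpow_mul hs.le]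
    calc s ^ (3 / 2 * p * (2 : ℕ)) ≤ s ^ (1 : ℝ) :=
          Real.rpow_le_rpow_of_exponent_ge hs hs1 (by push_cast; linarith)
      _ = s := Real.rpow_one s
  rw [Real.mul_rpow hL.le (by positivity), one_div, one_div, mul_inv, mul_pow]
  gcongr
  rw [inv_pow]
  gcongr

theorem exists_pos_solution {T p c μ : ℝ} {e : ℝ → ℝ} (hT : 0 < T) (hp : 1 / 3 ≤ p)
    (he : Function.Periodic e T) (he2 : MemL2Period T e) (hm : ∫ t in (0 : ℝ)..T, e t = 0)
    (hμ : 0 < μ) :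
    ∃ u Q, IsSystemSolution T c μ (fun t => ∫ s in (0 : ℝ)..t, e s) (fun x => 1 / x ^ p) u Q ∧
      ∀ t, 0 < u t := by
  have hp0 : 0 < p := by linarith
  have hei := he2.intervalIntegrable hT he
  have hPp := periodic_primitive he hei hm
  obtain ⟨K, hK, hbound⟩ := exists_apriori_bound c hT he he2 hm
  set r := (1 / μ) ^ (1 / p) with hr
  have hr0 : 0 < r := by positivity
  have hrp : 1 / r ^ p = μ := by
    rw [hr, ← Real.rpow_mul (by positivity), one_div_mul_cancel hp0.ne', Real.rpow_one,
      one_div_one_div]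
  set N := ∫ t in (0 : ℝ)..T, e t ^ 2 with hN
  have hN0 : 0 ≤ N := intervalIntegral.integral_nonneg hT.le fun t _ => sq_nonneg _
  set A := 2 * N + 2 * μ ^ 2 * T with hA
  have hA0 : 0 ≤ A := by positivity
  set D := (1 / (2 * K) ^ p) ^ 2 with hD
  have hD0 : 0 < D := by positivity
  set T₁ := min 1 T with hT₁
  have hT₁0 : 0 < T₁ := lt_min one_pos hT
  -- The first entry makes `D * log (T₁ / σ)` exceed `A`, which will bound the integral of `g(u)²`;
  -- the second keeps `δ` below `r`, the root of `1 / r ^ p = μ`.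
  set σ := min (T₁ * Real.exp (-(A / D + 1))) (r / (2 * K)) with hσ
  have hσ0 : 0 < σ := by positivity
  have hσlog : A < D * Real.log (T₁ / σ) := by
    have h1 : Real.exp (A / D + 1) ≤ T₁ / σ := by
      rw [le_div_iff₀ hσ0]
      calc Real.exp (A / D + 1) * σ
          ≤ Real.exp (A / D + 1) * (T₁ * Real.exp (-(A / D + 1))) := by
            gcongr; exact min_le_left _ _
        _ = T₁ * (Real.exp (A / D + 1) * Real.exp (-(A / D + 1))) := by ring
        _ = T₁ := by rw [← Real.exp_add]; simp
    have h2 := (Real.le_log_iff_exp_le (by positivity)).2 h1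
    calc A < D * (A / D + 1) := by rw [mul_add, mul_div_cancel₀ _ hD0.ne']; linarith
      _ ≤ _ := by gcongr
  have hσT : σ < T₁ := by
    refine (min_le_left _ _).trans_lt ?_
    have : Real.exp (-(A / D + 1)) < 1 := Real.exp_lt_one_iff.2 (by
      have : 0 ≤ A / D := by positivity
      linarith)
    nlinarith
  have hσ1 : σ ≤ 1 := hσT.le.trans (min_le_left _ _)
  have hs_le : ∀ s, 0 ≤ s → s ≤ 1 → s * √s ≤ s := fun s h0 h1 =>
    mul_le_of_le_one_right h0 (Real.sqrt_le_one.2 h1)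
  set δ := K * (σ * √σ) with hδ
  have hδ0 : 0 < δ := by positivity
  have hδr : δ < r := by
    have h1 : σ * (2 * K) ≤ r := (le_div_iff₀ (by positivity)).1 (min_le_right _ _)
    have h2 := hs_le σ hσ0.le hσ1
    nlinarith
  -- `r + K` already bounds `u`; the extra `2 * K` keeps the comparison values `2 * K * (s * √s)`,
  -- `s ≤ 1`, inside the untruncated range.
  set M := r + K + 2 * K with hM
  have hrM : r ≤ M := by linarith
  obtain ⟨g, g', m, l, hgd, hg'c, hg', hm0, hml, hlow, hupp, hgeq⟩ :=
    exists_truncation hp0 hδ0 (hδr.le.trans hrM)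
  have hgc : Continuous g := continuous_iff_continuousAt.2 fun x => (hgd x).continuousAt
  have hanti : Antitone g := fun x y hxy => by
    have := hlow x y hxy
    have : 0 ≤ m * (y - x) := mul_nonneg hm0.le (sub_nonneg.2 hxy)
    linarith
  obtain ⟨u, Q, hu⟩ := exists_system_of_lipschitz (c := c) (μ := μ) hT hPp
    (intervalIntegral.continuous_primitive hei 0) hm0 hml hgc hlow hupp
  have hguc : Continuous fun t => g (u t) := hgc.comp hu.continuous
  have hsq := hu.integral_sq_le hT he he2 hm (fun t => hgd (u t)) hg'c.continuousOn
    fun t => hg' (u t)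
  obtain ⟨hosc, t₀, h0, hgrow⟩ := hbound μ g u Q hu hguc hsq
  have hupper : ∀ t, u t ≤ M := fun t => by
    obtain ⟨t₁, ht₁⟩ := hu.exists_apply_eq hT hPp
    have h1 : g r = μ := by rw [hgeq r ⟨hδr.le, hrM⟩, hrp]
    have h2 : u t₁ ≤ r := by
      by_contra! hc
      have := hlow r (u t₁) hc.le
      have : 0 < m * (u t₁ - r) := mul_pos hm0 (sub_pos.2 hc)
      linarith
    linarith [hosc t₁ t]
  -- Otherwise `u(t₀ + s) ≤ 2 K s^(3/2)` for `s ≥ σ`, and integrating `g(u)² ≥ D / s` over `[σ, T₁]`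
  -- gives more than `A`.
  have hlower : δ ≤ u t₀ := by
    by_contra! hlt
    have hgint : ∫ t in (0 : ℝ)..T, g (u t) ^ 2 ≤ A := by
      have i1 : IntervalIntegrable (fun t => (μ - g (u t)) ^ 2) volume 0 T :=
        ((continuous_const.sub hguc).pow 2).intervalIntegrable 0 T
      have i2 : IntervalIntegrable (fun t => g (u t) ^ 2) volume 0 T :=
        (hguc.pow 2).intervalIntegrable 0 T
      have : ∫ t in (0 : ℝ)..T, g (u t) ^ 2
          ≤ ∫ t in (0 : ℝ)..T, (2 * (μ - g (u t)) ^ 2 + 2 * μ ^ 2) :=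
        intervalIntegral.integral_mono_on hT.le i2 ((i1.const_mul 2).add (by simp)) fun t _ => by
          nlinarith [sq_nonneg (2 * μ - g (u t))]
      rw [intervalIntegral.integral_add (i1.const_mul 2) (by simp),
        intervalIntegral.integral_const_mul, intervalIntegral.integral_const, smul_eq_mul] at this
      linarith
    have hshift : ∫ s in (0 : ℝ)..T, g (u (t₀ + s)) ^ 2 = ∫ t in (0 : ℝ)..T, g (u t) ^ 2 := by
      have hper : Function.Periodic (fun t => g (u t) ^ 2) T := fun t => by
        simp only [hu.periodic t]
      have := hper.intervalIntegral_add_eq t₀ 0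
      rw [zero_add] at this
      rw [← this, intervalIntegral.integral_comp_add_left (fun t => g (u t) ^ 2), add_zero]
    have hcs : Continuous fun s => g (u (t₀ + s)) ^ 2 :=
      (hguc.comp (continuous_const.add continuous_id)).pow 2
    have hsub : ∫ s in σ..T₁, g (u (t₀ + s)) ^ 2 ≤ ∫ s in (0 : ℝ)..T, g (u (t₀ + s)) ^ 2 :=
      intervalIntegral.integral_mono_interval hσ0.le hσT.le (min_le_right _ _)
        (Eventually.of_forall fun t => sq_nonneg _) (hcs.intervalIntegrable 0 T)
    have hinv : IntervalIntegrable (fun s : ℝ => D * s⁻¹) volume σ T₁ := by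
      apply ContinuousOn.intervalIntegrable
      rw [uIcc_of_le hσT.le]
      exact continuousOn_const.mul (continuousOn_id.inv₀ fun s hs => (hσ0.trans_le hs.1).ne')
    have hge : ∫ s in σ..T₁, D * s⁻¹ ≤ ∫ s in σ..T₁, g (u (t₀ + s)) ^ 2 := by
      refine intervalIntegral.integral_mono_on hσT.le hinv (hcs.intervalIntegrable σ T₁)
        fun s hs => ?_
      have hs0 : 0 < s := hσ0.trans_le hs.1
      have hs1 : s ≤ 1 := hs.2.trans (min_le_left _ _)
      have hδs : δ ≤ K * (s * √s) := by
        rw [hδ]; have := Real.sqrt_le_sqrt hs.1; gcongr; exact hs.1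
      have h2 : u (t₀ + s) ≤ 2 * K * (s * √s) := by
        have := hgrow s ⟨hs0.le, hs.2.trans (min_le_right _ _)⟩
        linarith
      have h3 : 2 * K * (s * √s) ∈ Icc δ M := by
        constructor
        · have : 0 < K * (s * √s) := by positivity
          linarith
        · have := hs_le s hs0.le hs1
          nlinarith
      have h4 := hanti h2
      rw [hgeq _ h3] at h4
      calc D * s⁻¹ ≤ (1 / (2 * K * (s * √s)) ^ p) ^ 2 :=
            le_one_div_rpow_sq hp (by positivity) hs0 hs1
        _ ≤ _ := by gcongr
    rw [intervalIntegral.integral_const_mul, integral_inv_of_pos hσ0 hT₁0] at hge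
    linarith
  have hδu : ∀ t, δ ≤ u t := fun t => hlower.trans (h0 t)
  refine ⟨u, Q, ⟨hu.periodic, hu.hasDerivAt, fun t => ?_⟩, fun t => hδ0.trans_le (hδu t)⟩
  have := hu.hasDerivAt_aux t
  rwa [hgeq _ ⟨hδu t, hupper t⟩] at this

/-! ### The average as a function of the parameter -/

/-- The intermediate value theorem gives surjectivity onto `(0, ∞)`. Continuity and limits of the
inverse then need only order comparisons. -/
theorem exists_strictAnti_inverse {ξ : ℝ → ℝ} (hanti : StrictAntiOn ξ (Ioi 0))
    (hcont : ContinuousOn ξ (Ioi 0)) (hpos : ∀ μ, 0 < μ → 0 < ξ μ)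
    (hlarge : ∀ B, ∃ μ, 0 < μ ∧ B ≤ ξ μ) (hsmall : ∀ ε, 0 < ε → ∃ μ, 0 < μ ∧ ξ μ ≤ ε) :
    ∃ φ : ℝ → ℝ, (∀ x, 0 < x → 0 < φ x ∧ ξ (φ x) = x) ∧ (∀ μ, 0 < μ → φ (ξ μ) = μ) ∧
      ContinuousOn φ (Ioi 0) ∧ StrictAntiOn φ (Ioi 0) ∧
      Tendsto φ (𝓝[>] 0) atTop ∧ Tendsto φ atTop (𝓝 0) := by
  have hsurj : ∀ x, ∃ μ, 0 < x → 0 < μ ∧ ξ μ = x := fun x => by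
    by_cases hx : 0 < x
    · obtain ⟨a, ha, hxa⟩ := hlarge x
      obtain ⟨b, hb, hbx⟩ := hsmall x hx
      obtain ⟨μ, hμ, h⟩ := isPreconnected_Ioi.intermediate_value (mem_Ioi.2 hb) (mem_Ioi.2 ha)
        hcont ⟨hbx, hxa⟩
      exact ⟨μ, fun _ => ⟨hμ, h⟩⟩
    · exact ⟨0, fun h => absurd h hx⟩
  choose φ hφ using hsurj
  have hφpos : ∀ x, 0 < x → 0 < φ x := fun x hx => (hφ x hx).1
  have hinv : ∀ μ, 0 < μ → φ (ξ μ) = μ := fun μ hμ =>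
    hanti.injOn (hφ _ (hpos μ hμ)).1 hμ (hφ _ (hpos μ hμ)).2
  -- `μ < φ x` and `x < ξ μ` are equivalent
  have hlt : ∀ x μ, 0 < x → 0 < μ → (μ < φ x ↔ x < ξ μ) := fun x μ hx hμ => by
    have := hanti.lt_iff_gt (hφpos x hx) hμ
    rw [(hφ x hx).2] at this
    exact this.symm
  have hgt : ∀ x μ, 0 < x → 0 < μ → (φ x < μ ↔ ξ μ < x) := fun x μ hx hμ => by
    have := hanti.lt_iff_gt hμ (hφpos x hx)
    rw [(hφ x hx).2] at this
    exact this.symm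
  refine ⟨φ, hφ, hinv, fun x hx => ?_, fun x hx y hy hxy => ?_, ?_, ?_⟩
  · refine ContinuousAt.continuousWithinAt (tendsto_order.2 ⟨fun a ha => ?_, fun a ha => ?_⟩)
    · rcases le_or_gt a 0 with h0 | h0
      · filter_upwards [Ioi_mem_nhds (mem_Ioi.1 hx)] with y hy
        exact h0.trans_lt (hφpos y hy)
      · filter_upwards [Ioi_mem_nhds (mem_Ioi.1 hx), Iio_mem_nhds ((hlt x a hx h0).1 ha)]
          with y hy hya
        exact (hlt y a hy h0).2 hya
    · have h0 : 0 < a := (hφpos x hx).trans ha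
      filter_upwards [Ioi_mem_nhds (mem_Ioi.1 hx), Ioi_mem_nhds ((hgt x a hx h0).1 ha)]
        with y hy hya
      exact (hgt y a hy h0).2 hya
  · rw [hlt x _ hx (hφpos y hy), (hφ y hy).2]
    exact hxy
  · refine tendsto_atTop.2 fun B => ?_
    have hB : 0 < max B 1 := lt_max_of_lt_right one_pos
    filter_upwards [self_mem_nhdsWithin,
      mem_nhdsWithin_of_mem_nhds (Iio_mem_nhds (hpos _ hB))] with y hy hyB
    exact (le_max_left B 1).trans ((hlt y _ hy hB).2 hyB).le
  · refine tendsto_order.2 ⟨fun a ha => ?_, fun a ha => ?_⟩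
    · filter_upwards [eventually_gt_atTop 0] with y hy
      exact ha.trans (hφpos y hy)
    · filter_upwards [eventually_gt_atTop 0, eventually_gt_atTop (ξ a)] with y hy hya
      exact (hgt y a hy ha).2 hya

/-- Lipschitz dependence on the parameter: at the maximum of `u₁ - u₂`, the maximum principle is
combined with the mean value theorem, the slope of `1 / x ^ p` being at most `-(p * M ^ (-p - 1))`
up to `M`. -/
theorem IsSystemSolution.sub_le {T p c μ₁ μ₂ M : ℝ} {P u₁ u₂ Q₁ Q₂ : ℝ → ℝ} (hT : 0 < T)
    (hp : 0 < p) (h₁ : IsSystemSolution T c μ₁ P (fun x => 1 / x ^ p) u₁ Q₁)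
    (h₂ : IsSystemSolution T c μ₂ P (fun x => 1 / x ^ p) u₂ Q₂)
    (p₁ : ∀ t, 0 < u₁ t) (p₂ : ∀ t, 0 < u₂ t) (hμ : μ₁ ≤ μ₂) (hM : ∀ t, u₁ t ≤ M) (t : ℝ) :
    p * M ^ (-p - 1) * (u₁ t - u₂ t) ≤ μ₂ - μ₁ := by
  have hM0 : 0 < M := (p₁ 0).trans_le (hM 0)
  have hle := le_of_le hT (strictAntiOn_one_div_rpow hp) h₂ h₁ p₂ p₁ hμ
  obtain ⟨t₀, hmax, h0⟩ := exists_max_sub hT h₁ h₂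
  have hpt : ∀ x ∈ Icc (u₂ t₀) (u₁ t₀), 0 < x := fun x hx => (p₂ t₀).trans_le hx.1
  have hmvt := (convex_Icc (u₂ t₀) (u₁ t₀)).image_sub_le_mul_sub_of_deriv_le
    (f := fun x : ℝ => 1 / x ^ p) (C := -(p * M ^ (-p - 1)))
    (fun x hx => (hasDerivAt_one_div_rpow p (hpt x hx)).continuousAt.continuousWithinAt)
    (fun x hx => (hasDerivAt_one_div_rpow p
      (hpt x (interior_subset hx))).differentiableAt.differentiableWithinAt)
    (fun x hx => by
      rw [(hasDerivAt_one_div_rpow p (hpt x (interior_subset hx))).deriv]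
      have hx' := interior_subset hx
      exact neg_le_neg (mul_le_mul_of_nonneg_left (Real.rpow_le_rpow_of_nonpos
        (hpt x hx') (hx'.2.trans (hM t₀)) (by linarith)) hp.le))
    (u₂ t₀) (left_mem_Icc.2 (hle t₀)) (u₁ t₀) (right_mem_Icc.2 (hle t₀)) (hle t₀)
  have h1 : p * M ^ (-p - 1) * (u₁ t - u₂ t) ≤ p * M ^ (-p - 1) * (u₁ t₀ - u₂ t₀) :=
    mul_le_mul_of_nonneg_left (hmax t) (by positivity)
  linarith

/-- The averages of the positive solutions, as a function of the parameter `μ > 0`, form a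
continuous strictly decreasing bijection of `(0, ∞)`. -/
theorem average_properties {T p c : ℝ} {e : ℝ → ℝ} (hT : 0 < T) (hp : 0 < p)
    (he : Function.Periodic e T) (he2 : MemL2Period T e) (hm : ∫ t in (0 : ℝ)..T, e t = 0)
    {U V : ℝ → ℝ → ℝ}
    (hU : ∀ μ, 0 < μ → IsSystemSolution T c μ (fun t => ∫ s in (0 : ℝ)..t, e s)
      (fun x => 1 / x ^ p) (U μ) (V μ)) (hpos : ∀ μ, 0 < μ → ∀ t, 0 < U μ t)
    {ξ : ℝ → ℝ} (hξ : ∀ μ, ξ μ * T = ∫ t in (0 : ℝ)..T, U μ t) :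
    StrictAntiOn ξ (Ioi 0) ∧ ContinuousOn ξ (Ioi 0) ∧ (∀ μ, 0 < μ → 0 < ξ μ) ∧
      (∀ B, ∃ μ, 0 < μ ∧ B ≤ ξ μ) ∧ (∀ ε, 0 < ε → ∃ μ, 0 < μ ∧ ξ μ ≤ ε) := by
  have hei := he2.intervalIntegrable hT he
  have hPp := periodic_primitive he hei hm
  have hg := strictAntiOn_one_div_rpow hp
  have hUi : ∀ μ, 0 < μ → IntervalIntegrable (U μ) volume 0 T := fun μ hμ =>
    (hU μ hμ).continuous.intervalIntegrable 0 T
  have hUle : ∀ μ ν, 0 < μ → μ ≤ ν → ∀ t, U ν t ≤ U μ t := fun μ ν hμ hμν =>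
    IsSystemSolution.le_of_le hT hg (hU ν (hμ.trans_le hμν)) (hU μ hμ)
      (hpos ν (hμ.trans_le hμν)) (hpos μ hμ) hμν
  have hbdd : ∀ μ, 0 < μ → ∃ M, ∀ ν, μ ≤ ν → ∀ t, U ν t ≤ M := fun μ hμ => by
    obtain ⟨t₀, h0⟩ := (hU μ hμ).periodic.exists_forall_le hT (hU μ hμ).continuous
    exact ⟨U μ t₀, fun ν hν t => (hUle μ ν hμ hν t).trans (h0 t)⟩
  have hξle : ∀ μ ν, 0 < μ → μ ≤ ν → ξ ν ≤ ξ μ := fun μ ν hμ hμν => by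
    refine le_of_mul_le_mul_right ?_ hT
    rw [hξ, hξ]
    exact intervalIntegral.integral_mono_on hT.le (hUi ν (hμ.trans_le hμν)) (hUi μ hμ)
      fun t _ => hUle μ ν hμ hμν t
  obtain ⟨K, hK, hbound⟩ := exists_apriori_bound c hT he he2 hm
  have hgc : ∀ μ, 0 < μ → Continuous fun t => 1 / U μ t ^ p := fun μ hμ =>
    continuous_const.div ((hU μ hμ).continuous.rpow_const fun t => Or.inl (hpos μ hμ t).ne')
      fun t => (Real.rpow_pos_of_pos (hpos μ hμ t) p).ne'
  have hsq : ∀ μ, 0 < μ → ∫ t in (0 : ℝ)..T, (μ - 1 / U μ t ^ p) ^ 2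
      ≤ ∫ t in (0 : ℝ)..T, e t ^ 2 := fun μ hμ =>
    IsSystemSolution.integral_sq_le (g := fun x => 1 / x ^ p) (u := U μ)
      (g' := fun x => -(p * x ^ (-p - 1))) hT he he2 hm (hU μ hμ)
      (fun t => hasDerivAt_one_div_rpow p (hpos μ hμ t))
      (by
        rintro _ ⟨t, rfl⟩
        exact (continuousAt_const.mul (Real.continuousAt_rpow_const _ _
          (Or.inl (hpos μ hμ t).ne'))).neg.continuousWithinAt)
      (fun t => neg_nonpos.2 (mul_nonneg hp.le (Real.rpow_nonneg (hpos μ hμ t).le _)))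
  refine ⟨fun μ hμ ν hν hlt => ?_, ?_, fun μ hμ => ?_, fun B => ?_, fun ε hε => ?_⟩
  · refine lt_of_le_of_ne (hξle μ ν hμ hlt.le) fun heq => hlt.ne ?_
    exact ((hU ν hν).eq_of_integral_eq hT hg (hU μ hμ) (hpos ν hν) (hpos μ hμ)
      (by rw [← hξ, ← hξ, heq])).2.symm
  · intro μ₀ hμ₀
    have ha : 0 < μ₀ / 2 := half_pos hμ₀
    obtain ⟨M, hM⟩ := hbdd _ ha
    have hM0 : 0 < M := (hpos _ ha 0).trans_le (hM _ le_rfl 0)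
    set m := p * M ^ (-p - 1) with hmdef
    have hm0 : 0 < m := by positivity
    have hLip : ∀ μ ν, μ₀ / 2 ≤ μ → μ ≤ ν → ξ μ - ξ ν ≤ m⁻¹ * (ν - μ) := fun μ ν hμ hμν => by
      have hμ0 := ha.trans_le hμ
      have hν0 := hμ0.trans_le hμν
      have h1 : ∫ t in (0 : ℝ)..T, (U μ t - U ν t) ≤ ∫ t in (0 : ℝ)..T, m⁻¹ * (ν - μ) :=
        intervalIntegral.integral_mono_on hT.le ((hUi μ hμ0).sub (hUi ν hν0)) (by simp)
          fun t _ => by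
          rw [le_inv_mul_iff₀ hm0]
          exact (hU μ hμ0).sub_le hT hp (hU ν hν0) (hpos μ hμ0) (hpos ν hν0) hμν (hM μ hμ) t
      rw [intervalIntegral.integral_sub (hUi μ hμ0) (hUi ν hν0), ← hξ, ← hξ,
        intervalIntegral.integral_const, smul_eq_mul, sub_zero] at h1
      refine le_of_mul_le_mul_right ?_ hT
      linarith
    have hL : LipschitzOnWith (Real.toNNReal m⁻¹) ξ (Ici (μ₀ / 2)) := by
      refine LipschitzOnWith.of_dist_le_mul fun μ hμ ν hν => ?_
      rw [Real.coe_toNNReal _ (inv_nonneg.2 hm0.le), Real.dist_eq, Real.dist_eq]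
      rcases le_total μ ν with h | h
      · rw [abs_of_nonneg (sub_nonneg.2 (hξle μ ν (ha.trans_le hμ) h)), abs_sub_comm μ ν,
          abs_of_nonneg (sub_nonneg.2 h)]
        exact hLip μ ν hμ h
      · rw [abs_sub_comm, abs_of_nonneg (sub_nonneg.2 (hξle ν μ (ha.trans_le hν) h)),
          abs_of_nonneg (sub_nonneg.2 h)]
        exact hLip ν μ hν h
    exact (hL.continuousOn.continuousAt (Ici_mem_nhds (half_lt_self hμ₀))).continuousWithinAt
  · have h1 : 0 < ξ μ * T := by
      rw [hξ]
      exact intervalIntegral.intervalIntegral_pos_of_pos (hUi μ hμ) (hpos μ hμ) hT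
    exact pos_of_mul_pos_left h1 hT.le
  -- For `μ = 1 / R ^ p` the solution takes the value `R` somewhere, and its oscillation is at most
  -- `K`, so it stays above `B`.
  · set R := max B 0 + K + 1 with hR
    have hR0 : 0 < R := by positivity
    have hμ : 0 < 1 / R ^ p := by positivity
    refine ⟨1 / R ^ p, hμ, ?_⟩
    obtain ⟨t₁, ht₁⟩ := (hU _ hμ).exists_apply_eq hT hPp
    have hut : U (1 / R ^ p) t₁ = R := hg.injOn (hpos _ hμ t₁) hR0 ht₁
    have hosc := (hbound _ _ _ _ (hU _ hμ) (hgc _ hμ) (hsq _ hμ)).1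
    have h1 : ∫ _ in (0 : ℝ)..T, B ≤ ∫ t in (0 : ℝ)..T, U (1 / R ^ p) t :=
      intervalIntegral.integral_mono_on hT.le (by simp) (hUi _ hμ) fun t _ => by
        have := hosc t t₁
        rw [hut] at this
        linarith [le_max_left B 0]
    rw [← hξ, intervalIntegral.integral_const, smul_eq_mul, sub_zero] at h1
    refine le_of_mul_le_mul_right ?_ hT
    linarith
  · obtain ⟨M, hM⟩ := hbdd 1 one_pos
    have hM0 : 0 < M := (hpos 1 one_pos 0).trans_le (hM 1 le_rfl 0)
    set N := ∫ t in (0 : ℝ)..T, e t ^ 2 with hN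
    have hN0 : 0 ≤ N := intervalIntegral.integral_nonneg hT.le fun t _ => sq_nonneg _
    set η := ε / 2 with hη
    have hη0 : 0 < η := half_pos hε
    have hgη : 0 < 1 / η ^ p := by positivity
    -- Where `U μ > η`, the quantity `μ - g(U μ)` is at least `s`, so a Chebyshev-type estimate
    -- bounds the contribution of that set by `M * N / s ^ 2`. This choice of `s` makes it at most
    -- `T * η`.
    set s := 1 + M * N / (T * η) with hs
    have hs1 : 1 ≤ s := by
      have : 0 ≤ M * N / (T * η) := by positivity
      linarith
    set μ := 1 / η ^ p + s with hμdef
    have hμ1 : 1 ≤ μ := by linarith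
    have hμ : 0 < μ := one_pos.trans_le hμ1
    refine ⟨μ, hμ, ?_⟩
    have hpt : ∀ t, U μ t ≤ η + M / s ^ 2 * (μ - 1 / U μ t ^ p) ^ 2 := fun t => by
      rcases le_or_gt (U μ t) η with h | h
      · have : 0 ≤ M / s ^ 2 * (μ - 1 / U μ t ^ p) ^ 2 := by positivity
        linarith
      · have h1 : 1 / U μ t ^ p < 1 / η ^ p := hg hη0 (hpos μ hμ t) h
        have h2 : s ≤ μ - 1 / U μ t ^ p := by linarith
        have h3 : s ^ 2 ≤ (μ - 1 / U μ t ^ p) ^ 2 := by gcongr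
        have h4 : M ≤ M / s ^ 2 * (μ - 1 / U μ t ^ p) ^ 2 := by
          calc M = M / s ^ 2 * s ^ 2 := by field_simp
            _ ≤ _ := by gcongr
        linarith [hM μ hμ1 t]
    have iq : IntervalIntegrable (fun t => (μ - 1 / U μ t ^ p) ^ 2) volume 0 T :=
      ((continuous_const.sub (hgc μ hμ)).pow 2).intervalIntegrable 0 T
    have hint := intervalIntegral.integral_mono_on hT.le (hUi μ hμ)
      ((by simp : IntervalIntegrable (fun _ => η) volume 0 T).add (iq.const_mul (M / s ^ 2)))
      fun t _ => hpt t
    rw [intervalIntegral.integral_add (by simp) (iq.const_mul _),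
      intervalIntegral.integral_const_mul, intervalIntegral.integral_const, smul_eq_mul,
      sub_zero, ← hξ] at hint
    have h5 : M / s ^ 2 * ∫ t in (0 : ℝ)..T, (μ - 1 / U μ t ^ p) ^ 2 ≤ M / s ^ 2 * N := by
      have := hsq μ hμ
      gcongr
    have h6 : M / s ^ 2 * N ≤ T * η := by
      rw [div_mul_eq_mul_div, div_le_iff₀ (by positivity)]
      calc M * N = T * η * (M * N / (T * η)) := by field_simp
        _ ≤ T * η * s ^ 2 := by
          gcongr
          nlinarith
    refine le_of_mul_le_mul_right ?_ hT
    have : ε = 2 * η := by rw [hη]; ring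
    rw [this]
    linarith

theorem hasAverage_iff {T ξ : ℝ} {u : ℝ → ℝ} (hu : Continuous u) :
    HasAverage T u ξ ↔ ξ * T = ∫ t in (0 : ℝ)..T, u t := by
  have key : ∫ t in (0 : ℝ)..T, (u t - ξ) = (∫ t in (0 : ℝ)..T, u t) - ξ * T := by
    rw [intervalIntegral.integral_sub (hu.intervalIntegrable 0 T) (by simp)]
    simp [mul_comm]
  constructor
  · rintro ⟨U, hU, h0⟩
    rw [show U = fun t => u t - ξ from funext fun t => by rw [hU]; ring, key] at h0
    linarith
  · intro h
    exact ⟨fun t => u t - ξ, fun t => by ring, by rw [key]; linarith⟩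

theorem mainTheorem4 (T p c : ℝ) (hT : 0 < T) (hp : 1 / 3 ≤ p) (e : ℝ → ℝ)
    (he_per : Function.Periodic e T) (he_L2 : MemL2Period T e)
    (he_mean : ∫ t in (0 : ℝ)..T, e t = 0) :
    -- there is exactly one positive periodic strong solution if and only if `μ > 0`
    (∀ μ : ℝ, (∃! u : ℝ → ℝ, IsPositivePeriodicSolution T p c e μ u) ↔ 0 < μ) ∧
    -- the average is a global parameter: it identifies the pair `(u, μ)`
    (∀ (ξ μ₁ μ₂ : ℝ) (u₁ u₂ : ℝ → ℝ),
      IsPositivePeriodicSolution T p c e μ₁ u₁ → HasAverage T u₁ ξ →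
      IsPositivePeriodicSolution T p c e μ₂ u₂ → HasAverage T u₂ ξ →
        u₁ = u₂ ∧ μ₁ = μ₂) ∧
    -- the solution set is the graph of a continuous decreasing function on `(ξ₀, ∞)`
    (∃ (ξ₀ : ℝ) (φ : ℝ → ℝ), 0 ≤ ξ₀ ∧
      solutionSet T p c e = {q : ℝ × ℝ | ξ₀ < q.1 ∧ q.2 = φ q.1} ∧
      ContinuousOn φ (Ioi ξ₀) ∧
      StrictAntiOn φ (Ioi ξ₀) ∧
      Tendsto φ (𝓝[>] ξ₀) atTop ∧
      Tendsto φ atTop (𝓝 0) ∧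
      (p ≤ 1 → ξ₀ = 0)) := by
  have hp0 : 0 < p := by linarith
  have hei := he_L2.intervalIntegrable hT he_per
  have hPp := periodic_primitive he_per hei he_mean
  have hg := strictAntiOn_one_div_rpow hp0
  have hμpos : ∀ μ u, IsPositivePeriodicSolution T p c e μ u → 0 < μ := fun μ u hu => by
    obtain ⟨Q, hQ⟩ := hu.exists_system hei
    obtain ⟨t, ht⟩ := hQ.exists_apply_eq hT hPp
    rw [← ht]
    exact one_div_pos.2 (Real.rpow_pos_of_pos (hu.pos t) p)
  have huniq : ∀ μ u v, IsPositivePeriodicSolution T p c e μ u →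
      IsPositivePeriodicSolution T p c e μ v → u = v := fun μ u v hu hv => by
    obtain ⟨Q, hQ⟩ := hu.exists_system hei
    obtain ⟨R, hR⟩ := hv.exists_system hei
    exact funext fun t => le_antisymm (hQ.le_of_le hT hg hR hu.pos hv.pos le_rfl t)
      (hR.le_of_le hT hg hQ hv.pos hu.pos le_rfl t)
  have hex : ∀ μ, ∃ u Q, 0 < μ → IsSystemSolution T c μ (fun t => ∫ s in (0 : ℝ)..t, e s)
      (fun x => 1 / x ^ p) u Q ∧ ∀ t, 0 < u t := fun μ => by
    by_cases hμ : 0 < μ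
    · obtain ⟨u, Q, h⟩ := exists_pos_solution (c := c) hT hp he_per he_L2 he_mean hμ
      exact ⟨u, Q, fun _ => h⟩
    · exact ⟨0, 0, fun h => absurd h hμ⟩
  choose U V hUV using hex
  have hU : ∀ μ, 0 < μ → IsPositivePeriodicSolution T p c e μ (U μ) := fun μ hμ =>
    (hUV μ hμ).1.isPositivePeriodicSolution hei he_L2 (hUV μ hμ).2
  have hpar : ∀ (ξ μ₁ μ₂ : ℝ) (u₁ u₂ : ℝ → ℝ),
      IsPositivePeriodicSolution T p c e μ₁ u₁ → HasAverage T u₁ ξ →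
      IsPositivePeriodicSolution T p c e μ₂ u₂ → HasAverage T u₂ ξ →
        u₁ = u₂ ∧ μ₁ = μ₂ := fun ξ μ₁ μ₂ u₁ u₂ h₁ a₁ h₂ a₂ => by
    obtain ⟨Q₁, hQ₁⟩ := h₁.exists_system hei
    obtain ⟨Q₂, hQ₂⟩ := h₂.exists_system hei
    exact hQ₁.eq_of_integral_eq hT hg hQ₂ h₁.pos h₂.pos
      (((hasAverage_iff h₁.continuous).1 a₁).symm.trans ((hasAverage_iff h₂.continuous).1 a₂))
  have hξ : ∀ μ, (fun μ => (∫ t in (0 : ℝ)..T, U μ t) / T) μ * T = ∫ t in (0 : ℝ)..T, U μ t :=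
    fun μ => div_mul_cancel₀ _ hT.ne'
  set ξ : ℝ → ℝ := fun μ => (∫ t in (0 : ℝ)..T, U μ t) / T
  obtain ⟨h1, h2, h3, h4, h5⟩ := average_properties hT hp0 he_per he_L2 he_mean
    (fun μ hμ => (hUV μ hμ).1) (fun μ hμ => (hUV μ hμ).2) hξ
  obtain ⟨φ, hφ, hinv, hc, ha, hl0, hl⟩ := exists_strictAnti_inverse h1 h2 h3 h4 h5
  -- The witness `ξ₀ = 0` works for all `p ≥ 1/3`, so the final clause for `p ≤ 1` holds by
  -- reflexivity.
  refine ⟨fun μ => ⟨fun ⟨u, hu, _⟩ => hμpos μ u hu, fun hμ =>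
    ⟨U μ, hU μ hμ, fun v hv => huniq μ v _ hv (hU μ hμ)⟩⟩, hpar,
    0, φ, le_rfl, ?_, hc, ha, hl0, hl, fun _ => rfl⟩
  ext ⟨x, μ⟩
  constructor
  · rintro ⟨u, hu, hav⟩
    have hμ := hμpos μ u hu
    have hxu := (hasAverage_iff hu.continuous).1 hav
    rw [huniq μ u _ hu (hU μ hμ), ← hξ] at hxu
    have hx : x = ξ μ := mul_right_cancel₀ hT.ne' hxu
    rw [hx]
    exact ⟨h3 μ hμ, (hinv μ hμ).symm⟩
  · rintro ⟨hx, hxμ⟩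
    obtain rfl : μ = φ x := hxμ
    obtain ⟨hpos, heq⟩ := hφ x hx
    exact ⟨U (φ x), hU _ hpos, (hasAverage_iff (hU _ hpos).continuous).2 (by
      simp only
      rw [← hξ, heq])⟩
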